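/- A house allocation instance with $n$ agents and $n$ houses is given by nonnegative utilities $u_i(h)$ of each agent $i$ for each house $h$. An allocation $\mathbf a=(a_1,\dots,a_n)$ assigns distinct houses to the agents, and a subsidy vector $\mathbf s=(s_1,\dots,s_n)$ consists of nonnegative real numbers. The outcome $(\mathbf a,\mathbf s)$ is envy-free (and $\mathbf s$ is envy-eliminating for $\mathbf a$) if $u_i(a_i)+s_i\ge u_i(a_{i'})+s_{i'}$ for all agents $i,i'$. It is a minimum-subsidy envy-free outcome if it is envy-free and $\sum_i s_i\le\sum_i s'_i$ for every envy-free outcome $(\mathbf a',\mathbf s')$. **Proposition.** When the number of houses equals the number of agents, a minimum-subsidy envy-free outcome can be computed in polynomial time: there is an algorithm which, given $n$ and the $n^2$ utilities as nonnegative rational numbers (fractions of integers written in binary), outputs an allocation and a rational subsidy vector that form a minimum-subsidy envy-free outcome, in time polynomial in the bit length of the input (on a random access machine with logarithmic cost). Moreover, for arbitrary nonnegative real utilities, every allocation $\mathbf a$ that is a maximum-weight perfect matching of the agent–house bipartite graph (that is, maximizes $\sum_i u_i(a_i)$ over all allocations) has an envy-eliminating subsidy vector of minimum total subsidy, and for every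 such vector $\mathbf s$, $(\mathbf a,\mathbf s)$ is a minimum-subsidy envy-free outcome. -/

import Mathlib

namespace HouseAllocation

/-! ## Envy-freeness with subsidies

Agents are the elements of `Fin n`, houses the elements of `Fin m`, and `u i h` is the utility of
agent `i` for house `h`.  An allocation, i.e. a list of `n` distinct houses, is an injection
`Fin n ↪ Fin m`. -/

/-- The outcome `(a, s)` consists of an allocation and a nonnegative subsidy vector, and no agent
prefers the bundle (house and subsidy) of another agent to her own.  Equivalently, `s` is
an envy-eliminating subsidy vector for `a`. -/
def IsEnvyFree {n m : ℕ} (u : Fin n → Fin m → ℝ) (a : Fin n ↪ Fin m) (s : Fin n → ℝ) : Prop :=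
  (∀ i, 0 ≤ s i) ∧ ∀ i i', u i (a i') + s i' ≤ u i (a i) + s i

/-- `(a, s)` is a minimum-subsidy envy-free outcome: it is envy-free, and its total subsidy is at
most that of every envy-free outcome `(a', s')`. -/
def IsMinSubsidyEnvyFree {n m : ℕ} (u : Fin n → Fin m → ℝ) (a : Fin n ↪ Fin m)
    (s : Fin n → ℝ) : Prop :=
  IsEnvyFree u a s ∧
    ∀ (a' : Fin n ↪ Fin m) (s' : Fin n → ℝ), IsEnvyFree u a' s' → ∑ i, s i ≤ ∑ i, s' i

/-- `s` is an envy-eliminating subsidy vector for the fixed allocation `a`, with minimum total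
among all envy-eliminating subsidy vectors for `a`. -/
def IsMinEnvyEliminating {n m : ℕ} (u : Fin n → Fin m → ℝ) (a : Fin n ↪ Fin m)
    (s : Fin n → ℝ) : Prop :=
  IsEnvyFree u a s ∧ ∀ s' : Fin n → ℝ, IsEnvyFree u a s' → ∑ i, s i ≤ ∑ i, s' i

/-- The matching of agents to houses given by `a` has maximum weight, the weight of the edge
between agent `i` and house `h` being `u i h`.  For `m = n`, the allocations are exactly the perfect
matchings of the complete bipartite graph between agents and houses. -/
def IsMaxWeight {n m : ℕ} (u : Fin n → Fin m → ℝ) (a : Fin n ↪ Fin m) : Prop :=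
  ∀ a' : Fin n ↪ Fin m, ∑ i, u i (a' i) ≤ ∑ i, u i (a i)

/-! ## A random access machine with logarithmic (bit) cost

Programs are while-programs over integer arrays.  A program mentions finitely many
arrays; array cells are addressed by computed integers (indirect addressing); a scalar variable is
a fixed cell of an array.  Every value that is read, computed, or used as an address is charged its
bit length, so that running times are polynomially related to those of Turing machines. -/

/-- A memory state: `σ x k` is the content of cell `k` of array `x`. -/
abbrev Store : Type := ℕ → ℤ → ℤ

/-- Integer expressions: constants, array access `x[e]`, and ring operations. -/
inductive Expr : Type
  | const (c : ℤ)
  | get (x : ℕ) (e : Expr)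
  | add (e₁ e₂ : Expr)
  | sub (e₁ e₂ : Expr)
  | mul (e₁ e₂ : Expr)

/-- The value of an expression. -/
def Expr.eval (σ : Store) : Expr → ℤ
  | .const c => c
  | .get x e => σ x (e.eval σ)
  | .add e₁ e₂ => e₁.eval σ + e₂.eval σ
  | .sub e₁ e₂ => e₁.eval σ - e₂.eval σ
  | .mul e₁ e₂ => e₁.eval σ * e₂.eval σ

/-- The charge for handling an integer: one plus the bit length of its absolute value. -/
def bitCost (z : ℤ) : ℕ := 1 + z.natAbs.size

/-- The cost of evaluating an expression: the charges for the values of all its subexpressions. -/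
def Expr.cost (σ : Store) : Expr → ℕ
  | .const c => bitCost c
  | .get x e => e.cost σ + bitCost (σ x (e.eval σ))
  | .add e₁ e₂ => e₁.cost σ + e₂.cost σ + bitCost (e₁.eval σ + e₂.eval σ)
  | .sub e₁ e₂ => e₁.cost σ + e₂.cost σ + bitCost (e₁.eval σ - e₂.eval σ)
  | .mul e₁ e₂ => e₁.cost σ + e₂.cost σ + bitCost (e₁.eval σ * e₂.eval σ)

/-- Programs. `assign x e₁ e₂` is the assignment `x[e₁] := e₂`, and the guard of a conditional or
of a loop is the test `0 < e`. -/
inductive Program : Type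
  | skip
  | assign (x : ℕ) (e₁ e₂ : Expr)
  | seq (p q : Program)
  | ite (e : Expr) (p q : Program)
  | loop (e : Expr) (p : Program)

/-- The store obtained from `σ` by writing `v` into cell `k` of array `x`. -/
def Store.write (σ : Store) (x : ℕ) (k v : ℤ) : Store :=
  fun y l => if y = x ∧ l = k then v else σ y l

/-- `Exec p σ t σ'`: started in the store `σ`, the program `p` halts in the store `σ'`, and the
run has cost `t`. -/
inductive Exec : Program → Store → ℕ → Store → Prop
  | skip (σ : Store) : Exec .skip σ 1 σ
  | assign (σ : Store) (x : ℕ) (e₁ e₂ : Expr) :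
      Exec (.assign x e₁ e₂) σ (1 + e₁.cost σ + e₂.cost σ) (σ.write x (e₁.eval σ) (e₂.eval σ))
  | seq {p q : Program} {σ σ' σ'' : Store} {t t' : ℕ} :
      Exec p σ t σ' → Exec q σ' t' σ'' → Exec (.seq p q) σ (1 + t + t') σ''
  | ite_pos {e : Expr} {p q : Program} {σ σ' : Store} {t : ℕ} :
      0 < e.eval σ → Exec p σ t σ' → Exec (.ite e p q) σ (1 + e.cost σ + t) σ'
  | ite_neg {e : Expr} {p q : Program} {σ σ' : Store} {t : ℕ} :
      ¬ 0 < e.eval σ → Exec q σ t σ' → Exec (.ite e p q) σ (1 + e.cost σ + t) σ'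
  | loop_pos {e : Expr} {p : Program} {σ σ' σ'' : Store} {t t' : ℕ} :
      0 < e.eval σ → Exec p σ t σ' → Exec (.loop e p) σ' t' σ'' →
        Exec (.loop e p) σ (1 + e.cost σ + t + t') σ''
  | loop_neg {e : Expr} {p : Program} {σ : Store} :
      ¬ 0 < e.eval σ → Exec (.loop e p) σ (1 + e.cost σ) σ

/-- The initial store on input `l`: array `0` holds the length of `l` in cell `0` and the entries
of `l` in the cells `1, 2, …`; all other cells are `0`. -/
def inputStore (l : List ℕ) : Store :=
  fun x k => if x = 0 ∧ 0 ≤ k then (((l.length :: l).getD k.toNat 0 : ℕ) : ℤ) else 0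

/-- The store `σ` holds the output `l`: array `1` holds the length of `l` in cell `0` and the
entries of `l` in the cells `1, …, l.length`. -/
def HoldsOutput (σ : Store) (l : List ℕ) : Prop :=
  ∀ k : ℕ, k ≤ l.length → σ 1 (k : ℤ) = (((l.length :: l).getD k 0 : ℕ) : ℤ)

/-- The input size: the total number of bits of the entries, plus one separator per entry. -/
def inputSize (l : List ℕ) : ℕ := (l.map fun w => w.size + 1).sum

/-- The search problem with input encoding `enc` and correctness relation `R` between inputs and
output lists is solvable in polynomial time: a single program, within a single
polynomial time bound, computes a correct output for every input. -/
def SolvableInPolyTime {ι : Type} (enc : ι → List ℕ) (R : ι → List ℕ → Prop) : Prop :=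
  ∃ (p : Program) (P : Polynomial ℕ), ∀ x : ι, ∃ (t : ℕ) (σ : Store) (out : List ℕ),
    Exec p (inputStore (enc x)) t σ ∧ t ≤ P.eval (inputSize (enc x)) ∧ HoldsOutput σ out ∧ R x out

/-! ## The computational problem -/

/-- A house allocation problem instance with `n` agents and `m` houses whose utilities are
nonnegative rational numbers, given as fractions of natural numbers. -/
structure RatInstance (n m : ℕ) : Type where
  num : Fin n → Fin m → ℕ
  den : Fin n → Fin m → ℕ
  den_pos : ∀ i h, 0 < den i h

/-- The utility of agent `i` for house `h`. -/
noncomputable def RatInstance.utility {n m : ℕ} (I : RatInstance n m) (i : Fin n) (h : Fin m) : ℝ :=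
  (I.num i h : ℝ) / (I.den i h : ℝ)

/-- The input list of an instance: `n`, `m`, then the matrix of numerators and the
matrix of denominators, row by row. -/
def RatInstance.encode {n m : ℕ} (I : RatInstance n m) : List ℕ :=
  n :: m :: ((List.ofFn fun k : Fin (n * m) => I.num k.divNat k.modNat) ++
    List.ofFn fun k : Fin (n * m) => I.den k.divNat k.modNat)

/-- The output list of an outcome with rational subsidies: the houses (numbered from `0`) of the
agents, then the numerators and then the denominators of the agents' subsidies. -/
def encodeOutcome {n m : ℕ} (a : Fin n ↪ Fin m) (num den : Fin n → ℕ) : List ℕ :=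
  (List.ofFn fun i => (a i : ℕ)) ++ List.ofFn num ++ List.ofFn den

/-- The list `out` represents a minimum-subsidy envy-free outcome of the instance `I`. -/
def IsSolution {n m : ℕ} (I : RatInstance n m) (out : List ℕ) : Prop :=
  ∃ (a : Fin n ↪ Fin m) (num den : Fin n → ℕ), out = encodeOutcome a num den ∧
    (∀ i, 0 < den i) ∧
    IsMinSubsidyEnvyFree I.utility a fun i => (num i : ℝ) / (den i : ℝ)

end HouseAllocation

/-! Subsidies of agents are read as prices of houses: each house gets the subsidy of its owner. With
as many houses as agents every house is owned, so envy-freeness says that each agent holds a house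
maximizing utility plus price. Summed over the agents the prices cancel, so the allocation has
maximum weight (`IsEnvyFree.isMaxWeight`). Equality in that sum shows that the same prices, with the
same total, support every maximum-weight matching (`IsEnvyFree.transfer`). It therefore suffices to
minimize subsidies for one such matching, and there the pointwise infimum of all envy-eliminating
vectors is again envy-eliminating.

The algorithm is a form of the Hungarian method, run on integers obtained by multiplying the
utilities by the product of all denominators. It starts from zero utilities and brings in the true
utilities one agent at a time. For a new agent `k`, prices are lowered until edges of zero slack
form a tree directed to `k` that spans all agents. Then `k` takes her favourite bundle, and the
agents on the tree path from its owner back to `k` each move on to the next house, between which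
they are indifferent (`growTree_spec`, `exchange_spec`, `insertAgent_spec`). Once all agents are in,
a tree is grown towards each root `k` in turn. Along it the price difference between `j` and `k` is
the least that any envy-free prices allow, and the maximum over `k` is the pointwise least subsidy
of `j` (`computeSubsidies_spec`).

For the running time, all loops have `n` iterations, and each product in a stored value has an input
entry as a factor. An assignment thus adds to the bit length in memory an amount linear in the input
size, instead of multiplying it, and polynomial bounds survive nesting of loops (`Cmd.exists_exec`).

For real utilities, envy-free outcomes come from the rational case by rounding and compactness
(`exists_isEnvyFree_of_rat`). -/

namespace HouseAllocation

open Polynomial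

/-! ## Bounded loops -/

/-- Programs with bounded loops only: `forN i p` runs `p` for each value `0, …, n - 1` of the
counter `i[0]`, where `n` is the content of cell `1` of the input array `0`. -/
inductive Cmd : Type
  | skip
  | assign (x : ℕ) (e₁ e₂ : Expr)
  | seq (p q : Cmd)
  | ite (e : Expr) (p q : Cmd)
  | forN (i : ℕ) (p : Cmd)

namespace Cmd

/-- The states of a bounded loop with counter `i` and body `f` after `r` iterations. -/
def iter (i : ℕ) (f : Store → Store) (σ : Store) : ℕ → Store
  | 0 => σ.write i 0 0
  | r + 1 => (f (iter i f σ r)).write i 0 ((r : ℤ) + 1)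

/-- The final store of a command. -/
def run : Cmd → Store → Store
  | skip, σ => σ
  | assign x e₁ e₂, σ => σ.write x (e₁.eval σ) (e₂.eval σ)
  | seq p q, σ => q.run (p.run σ)
  | ite e p q, σ => if 0 < e.eval σ then p.run σ else q.run σ
  | forN i p, σ => iter i p.run σ (σ 0 1).toNat

/-- The translation to while-programs. -/
def compile : Cmd → Program
  | skip => .skip
  | assign x e₁ e₂ => .assign x e₁ e₂
  | seq p q => .seq p.compile q.compile
  | ite e p q => .ite e p.compile q.compile
  | forN i p => .seq (.assign i (.const 0) (.const 0))
      (.loop (.sub (.get 0 (.const 1)) (.get i (.const 0)))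
        (.seq p.compile (.assign i (.const 0) (.add (.get i (.const 0)) (.const 1)))))

/-- The arrays that a command may write to. -/
def writes : Cmd → List ℕ
  | skip => []
  | assign x _ _ => [x]
  | seq p q => p.writes ++ q.writes
  | ite _ p q => p.writes ++ q.writes
  | forN i p => i :: p.writes

end Cmd

/-- Products are only taken with an entry of the input array on the left. -/
def Expr.isLinear : Expr → Bool
  | .const _ => true
  | .get _ _ => true
  | .add e₁ e₂ => e₁.isLinear && e₂.isLinear
  | .sub e₁ e₂ => e₁.isLinear && e₂.isLinear
  | .mul (.get 0 _) e₂ => e₂.isLinear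
  | .mul _ _ => false

/-- The command never changes the input array, loop counters are not changed by loop bodies, and
stored values depend linearly on the memory outside of the input. -/
def Cmd.wf : Cmd → Bool
  | .skip => true
  | .assign x _ e₂ => x != 0 && e₂.isLinear
  | .seq p q => p.wf && q.wf
  | .ite _ p q => p.wf && q.wf
  | .forN i p => i != 0 && !(p.writes.contains i) && p.wf

/-! ### Frame and invariant rules for commands. -/

theorem Store.write_same (σ : Store) (x : ℕ) (k v l : ℤ) :
    σ.write x k v x l = if l = k then v else σ x l := by
  simp [Store.write]

theorem Store.write_ne (σ : Store) {x y : ℕ} (k v : ℤ) (h : y ≠ x) : σ.write x k v y = σ y := by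
  funext l; simp [Store.write, h]

namespace Cmd

theorem iter_of_ne {i y : ℕ} {f : Store → Store} (hf : ∀ τ, f τ y = τ y) (hy : y ≠ i) (σ : Store)
    (r : ℕ) : iter i f σ r y = σ y := by
  induction r with
  | zero => exact Store.write_ne _ _ _ hy
  | succ r ih => rw [iter, Store.write_ne _ _ _ hy, hf, ih]

theorem run_of_notMem {y : ℕ} (c : Cmd) (h : y ∉ c.writes) (σ : Store) : c.run σ y = σ y := by
  induction c generalizing σ with
  | skip => rfl
  | assign x e₁ e₂ => exact Store.write_ne _ _ _ (by simpa [writes] using h)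
  | seq p q ihp ihq =>
    simp only [writes, List.mem_append, not_or] at h
    rw [run, ihq h.2, ihp h.1]
  | ite e p q ihp ihq =>
    simp only [writes, List.mem_append, not_or] at h
    rw [run]; split_ifs
    exacts [ihp h.1 σ, ihq h.2 σ]
  | forN i p ih =>
    simp only [writes, List.mem_cons, not_or] at h
    exact iter_of_ne (ih h.2) h.1 _ _

theorem iter_counter (i : ℕ) (f : Store → Store) (σ : Store) (r : ℕ) :
    iter i f σ r i 0 = r := by
  cases r <;> simp [iter, Store.write_same]

theorem zero_notMem_writes {c : Cmd} (h : c.wf = true) : 0 ∉ c.writes := by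
  induction c with
  | skip => simp [writes]
  | assign x e₁ e₂ => simp [wf] at h; simp [writes]; omega
  | seq p q ihp ihq => simp [wf] at h; simp [writes, ihp h.1, ihq h.2]
  | ite e p q ihp ihq => simp [wf] at h; simp [writes, ihp h.1, ihq h.2]
  | forN i p ih => simp [wf] at h; simp [writes, ih h.2]; omega

theorem run_zero {c : Cmd} (h : c.wf = true) (σ : Store) : c.run σ 0 = σ 0 :=
  run_of_notMem c (zero_notMem_writes h) σ

/-- The invariant rule for bounded loops. -/
theorem forN_induction {i : ℕ} {p : Cmd} {σ : Store} {n : ℕ} (hn : σ 0 1 = n)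
    {I : ℕ → Store → Prop} (h0 : I 0 (σ.write i 0 0))
    (hs : ∀ (r : ℕ) (τ : Store), r < n → τ i 0 = (r : ℤ) → (∀ y, y ∉ i :: p.writes → τ y = σ y) → I r τ →
      I (r + 1) ((p.run τ).write i 0 ((r : ℤ) + 1))) :
    I n ((forN i p).run σ) := by
  have key : ∀ r, r ≤ n → I r (iter i p.run σ r) := by
    intro r
    induction r with
    | zero => exact fun _ => h0
    | succ r ih =>
      intro hr
      refine hs r _ hr (iter_counter _ _ _ _) (fun y hy => ?_) (ih (by omega))
      simp only [List.mem_cons, not_or] at hy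
      exact iter_of_ne (fun τ => run_of_notMem p hy.2 τ) hy.1 _ _
  have := key n le_rfl
  simpa [run, hn] using this

end Cmd

/-! ## Running times -/

theorem bitCost_le {z : ℤ} {m : ℕ} (h : z.natAbs ≤ 2 ^ m) : bitCost z ≤ m + 2 := by
  have : z.natAbs.size ≤ m + 1 := Nat.size_le.2 (lt_of_le_of_lt h (by
    rw [pow_succ]; have := Nat.two_pow_pos m; omega))
  unfold bitCost; omega

/-- All cells hold integers of absolute value at most `2 ^ m`. -/
def Store.Bounded (σ : Store) (m : ℕ) : Prop := ∀ x k, (σ x k).natAbs ≤ 2 ^ m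

theorem two_pow_add_two_pow_le (a b : ℕ) : 2 ^ a + 2 ^ b ≤ 2 ^ (a + b + 1) := by
  have h1 : 2 ^ a ≤ 2 ^ (a + b) := Nat.pow_le_pow_right (by norm_num) (by omega)
  have h2 : 2 ^ b ≤ 2 ^ (a + b) := Nat.pow_le_pow_right (by norm_num) (by omega)
  rw [pow_succ]; omega

/-- Each operation at most adds bit lengths up to a constant, so `K` depends on the expression
alone. This suffices for costs, but not for stored values: iterating a factor `K` in a loop would be
exponential. -/
theorem Expr.exists_cost_le (e : Expr) : ∃ K : ℕ, ∀ (σ : Store) (m : ℕ), 1 ≤ m → σ.Bounded m →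
    (e.eval σ).natAbs ≤ 2 ^ (K * m) ∧ e.cost σ ≤ K * m := by
  have comb : ∀ {K₁ K₂ m A c₁ c₂ : ℕ} {z : ℤ}, 1 ≤ m → z.natAbs ≤ 2 ^ A →
      A ≤ K₁ * m + K₂ * m + 1 → c₁ ≤ K₁ * m → c₂ ≤ K₂ * m →
      z.natAbs ≤ 2 ^ ((2 * K₁ + 2 * K₂ + 3) * m) ∧
        c₁ + c₂ + bitCost z ≤ (2 * K₁ + 2 * K₂ + 3) * m := by
    intro K₁ K₂ m A c₁ c₂ z hm hz hA h1 h2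
    have := bitCost_le hz
    have e : (2 * K₁ + 2 * K₂ + 3) * m = 2 * (K₁ * m) + 2 * (K₂ * m) + 3 * m := by ring
    refine ⟨hz.trans (Nat.pow_le_pow_right (by norm_num) ?_), ?_⟩ <;> rw [e] <;> omega
  induction e with
  | const c =>
    refine ⟨bitCost c, fun σ m hm _ => ⟨?_, ?_⟩⟩
    · refine (Nat.lt_size_self _).le.trans (Nat.pow_le_pow_right (by norm_num) ?_)
      have : bitCost c * 1 ≤ bitCost c * m := Nat.mul_le_mul_left _ hm
      unfold bitCost at *; simp only [eval]; omega
    · simpa [cost] using Nat.mul_le_mul_left (bitCost c) hm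
  | get x e ih =>
    obtain ⟨K, hK⟩ := ih
    refine ⟨K + 3, fun σ m hm hσ => ⟨(hσ _ _).trans (Nat.pow_le_pow_right (by norm_num) ?_), ?_⟩⟩
    · nlinarith
    · have := (hK σ m hm hσ).2
      have := bitCost_le (hσ x (e.eval σ))
      simp only [cost]; nlinarith
  | add e₁ e₂ ih₁ ih₂ =>
    obtain ⟨K₁, h₁⟩ := ih₁
    obtain ⟨K₂, h₂⟩ := ih₂
    refine ⟨_, fun σ m hm hσ => comb hm ?_ le_rfl (h₁ σ m hm hσ).2 (h₂ σ m hm hσ).2⟩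
    exact (Int.natAbs_add_le _ _).trans ((add_le_add (h₁ σ m hm hσ).1 (h₂ σ m hm hσ).1).trans
      (two_pow_add_two_pow_le _ _))
  | sub e₁ e₂ ih₁ ih₂ =>
    obtain ⟨K₁, h₁⟩ := ih₁
    obtain ⟨K₂, h₂⟩ := ih₂
    refine ⟨_, fun σ m hm hσ => comb hm ?_ le_rfl (h₁ σ m hm hσ).2 (h₂ σ m hm hσ).2⟩
    exact (Int.natAbs_sub_le _ _).trans ((add_le_add (h₁ σ m hm hσ).1 (h₂ σ m hm hσ).1).trans
      (two_pow_add_two_pow_le _ _))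
  | mul e₁ e₂ ih₁ ih₂ =>
    obtain ⟨K₁, h₁⟩ := ih₁
    obtain ⟨K₂, h₂⟩ := ih₂
    refine ⟨_, fun σ m hm hσ => comb hm (A := K₁ * m + K₂ * m) ?_ (by omega)
      (h₁ σ m hm hσ).2 (h₂ σ m hm hσ).2⟩
    simp only [eval]
    rw [Int.natAbs_mul, pow_add]
    exact Nat.mul_le_mul (h₁ σ m hm hσ).1 (h₂ σ m hm hσ).1

/-- The point is the coefficient one of `m`: a factor from the input contributes only `S` bits, so
the growth is additive and independent of the present memory contents. -/
theorem Expr.exists_eval_le_of_isLinear (e : Expr) (he : e.isLinear = true) :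
    ∃ K : ℕ, ∀ (σ : Store) (S m : ℕ), 1 ≤ S → (∀ k, (σ 0 k).natAbs ≤ 2 ^ S) → σ.Bounded m →
      (e.eval σ).natAbs ≤ 2 ^ (m + K * S) := by
  have comb : ∀ {K₁ K₂ S m : ℕ} {x y : ℕ}, 1 ≤ S → x ≤ 2 ^ (m + K₁ * S) → y ≤ 2 ^ (m + K₂ * S) →
      x + y ≤ 2 ^ (m + (K₁ + K₂ + 1) * S) := by
    intro K₁ K₂ S m x y hS hx hy
    have hx' : x ≤ 2 ^ (m + (K₁ + K₂) * S) := hx.trans (Nat.pow_le_pow_right (by norm_num)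
      (by gcongr; omega))
    have hy' : y ≤ 2 ^ (m + (K₁ + K₂) * S) := hy.trans (Nat.pow_le_pow_right (by norm_num)
      (by gcongr; omega))
    calc x + y ≤ 2 ^ (m + (K₁ + K₂) * S + 1) := by rw [pow_succ]; omega
      _ ≤ _ := Nat.pow_le_pow_right (by norm_num) (by rw [add_mul (K₁ + K₂)]; omega)
  induction e with
  | const c =>
    refine ⟨bitCost c, fun σ S m hS _ _ => ?_⟩
    refine (Nat.lt_size_self _).le.trans (Nat.pow_le_pow_right (by norm_num) ?_)
    have : bitCost c * 1 ≤ bitCost c * S := Nat.mul_le_mul_left _ hS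
    unfold bitCost at *; simp only [eval]; omega
  | get x e ih => exact ⟨0, fun σ S m hS _ hσ => by simpa [eval] using hσ x (e.eval σ)⟩
  | add e₁ e₂ ih₁ ih₂ =>
    simp only [isLinear, Bool.and_eq_true] at he
    obtain ⟨K₁, h₁⟩ := ih₁ he.1
    obtain ⟨K₂, h₂⟩ := ih₂ he.2
    exact ⟨_, fun σ S m hS h0 hσ => (Int.natAbs_add_le _ _).trans
      (comb hS (h₁ σ S m hS h0 hσ) (h₂ σ S m hS h0 hσ))⟩
  | sub e₁ e₂ ih₁ ih₂ =>
    simp only [isLinear, Bool.and_eq_true] at he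
    obtain ⟨K₁, h₁⟩ := ih₁ he.1
    obtain ⟨K₂, h₂⟩ := ih₂ he.2
    exact ⟨_, fun σ S m hS h0 hσ => (Int.natAbs_sub_le _ _).trans
      (comb hS (h₁ σ S m hS h0 hσ) (h₂ σ S m hS h0 hσ))⟩
  | mul e₁ e₂ ih₁ ih₂ =>
    obtain ⟨x, rfl⟩ : ∃ x, e₁ = .get 0 x := by
      unfold isLinear at he; split at he <;> simp_all
    obtain ⟨K₂, h₂⟩ := ih₂ (by simpa [isLinear] using he)
    refine ⟨K₂ + 1, fun σ S m hS h0 hσ => ?_⟩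
    simp only [eval]
    rw [Int.natAbs_mul, show m + (K₂ + 1) * S = S + (m + K₂ * S) by ring, pow_add]
    exact Nat.mul_le_mul (h0 _) (h₂ σ S m hS h0 hσ)

theorem eval_mono_of_nat (P : ℕ[X]) : Monotone fun x => P.eval x := by
  intro x y h
  induction P using Polynomial.induction_on' with
  | add p q hp hq => simpa using add_le_add hp hq
  | monomial k a => simpa using Nat.mul_le_mul_left a (Nat.pow_le_pow_left h k)

theorem Store.Bounded.mono {σ : Store} {m m' : ℕ} (h : σ.Bounded m) (hm : m ≤ m') :
    σ.Bounded m' :=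
  fun x k => (h x k).trans (Nat.pow_le_pow_right (by norm_num) hm)

theorem Store.Bounded.write {σ : Store} {m : ℕ} (h : σ.Bounded m) {x : ℕ} {k v : ℤ}
    (hv : v.natAbs ≤ 2 ^ m) : (σ.write x k v).Bounded m := by
  intro y l
  unfold Store.write
  split_ifs
  exacts [hv, h y l]

/-- A well-formed command runs in polynomial time, and increases the bit lengths in memory by
at most a polynomial in the input size. -/
theorem Cmd.exists_exec (c : Cmd) (hc : c.wf = true) : ∃ G T : ℕ[X], ∀ (S m : ℕ) (σ : Store) (n : ℕ),
    1 ≤ S → S ≤ m → σ 0 1 = n → n ≤ S → (∀ k, (σ 0 k).natAbs ≤ 2 ^ S) → σ.Bounded m →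
      (∃ t, Exec c.compile σ t (c.run σ) ∧ t ≤ T.eval m) ∧ (c.run σ).Bounded (m + G.eval S) := by
  induction c with
  | skip =>
    refine ⟨0, 1, fun S m σ n _ _ _ _ _ hσ => ⟨⟨1, .skip σ, by simp⟩, by simpa [run] using hσ⟩⟩
  | assign x e₁ e₂ =>
    simp only [wf, Bool.and_eq_true] at hc
    obtain ⟨K₁, h₁⟩ := e₁.exists_cost_le
    obtain ⟨K₂, h₂⟩ := e₂.exists_cost_le
    obtain ⟨K, h⟩ := e₂.exists_eval_le_of_isLinear hc.2
    -- Growth is a polynomial in `S`, time a polynomial in `m`. Keeping them apart is what makes the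
    -- induction work for loops.
    refine ⟨C K * X, 1 + C (K₁ + K₂) * X, fun S m σ n hS hm _ _ h0 hσ => ⟨⟨_, .assign .., ?_⟩, ?_⟩⟩
    · have := (h₁ σ m (by omega) hσ).2
      have := (h₂ σ m (by omega) hσ).2
      simp only [eval_add, eval_one, eval_mul, eval_C, eval_X]
      nlinarith
    · refine (hσ.mono (by omega)).write ?_
      simpa using h σ S m hS h0 hσ
  | seq p q ihp ihq =>
    simp only [wf, Bool.and_eq_true] at hc
    obtain ⟨G₁, T₁, h₁⟩ := ihp hc.1
    obtain ⟨G₂, T₂, h₂⟩ := ihq hc.2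
    refine ⟨G₁ + G₂, 1 + T₁ + T₂.comp (X + G₁), fun S m σ n hS hm hn hnS h0 hσ => ?_⟩
    obtain ⟨⟨t₁, e₁, b₁⟩, B₁⟩ := h₁ S m σ n hS hm hn hnS h0 hσ
    have hz := run_zero hc.1 σ
    obtain ⟨⟨t₂, e₂, b₂⟩, B₂⟩ := h₂ S (m + G₁.eval S) (p.run σ) n hS (by omega)
      (by rw [hz, hn]) hnS (by rwa [hz]) B₁
    refine ⟨⟨_, .seq e₁ e₂, ?_⟩, ?_⟩
    · have : T₂.eval (m + G₁.eval S) ≤ T₂.eval (m + G₁.eval m) :=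
        eval_mono_of_nat T₂ (by have := eval_mono_of_nat G₁ hm; simp only at this; omega)
      simp only [eval_add, eval_one, eval_comp, eval_X]
      omega
    · simpa [add_assoc, run] using B₂
  | ite e p q ihp ihq =>
    simp only [wf, Bool.and_eq_true] at hc
    obtain ⟨G₁, T₁, h₁⟩ := ihp hc.1
    obtain ⟨G₂, T₂, h₂⟩ := ihq hc.2
    obtain ⟨K, h⟩ := e.exists_cost_le
    refine ⟨G₁ + G₂, 1 + C K * X + T₁ + T₂, fun S m σ n hS hm hn hnS h0 hσ => ?_⟩
    have hK := (h σ m (by omega) hσ).2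
    simp only [eval_add, eval_one, eval_mul, eval_C, eval_X]
    by_cases hpos : 0 < e.eval σ
    · obtain ⟨⟨t₁, e₁, b₁⟩, B₁⟩ := h₁ S m σ n hS hm hn hnS h0 hσ
      rw [run, if_pos hpos]
      exact ⟨⟨_, .ite_pos hpos e₁, by omega⟩, B₁.mono (by omega)⟩
    · obtain ⟨⟨t₁, e₁, b₁⟩, B₁⟩ := h₂ S m σ n hS hm hn hnS h0 hσ
      rw [run, if_neg hpos]
      exact ⟨⟨_, .ite_neg hpos e₁, by omega⟩, B₁.mono (by omega)⟩
  | forN i p ih =>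
    simp only [wf, Bool.and_eq_true, Bool.not_eq_true', bne_iff_ne, List.contains_eq_mem,
      decide_eq_false_iff_not] at hc
    obtain ⟨⟨hi, hip⟩, hp⟩ := hc
    obtain ⟨G, T, h⟩ := ih hp
    obtain ⟨K₁, h₁⟩ := (Expr.sub (.get 0 (.const 1)) (.get i (.const 0))).exists_cost_le
    obtain ⟨K₂, h₂⟩ := (Expr.add (.get i (.const 0)) (.const 1)).exists_cost_le
    -- `V` bounds the bit length in memory during the whole loop, since at most `S ≤ m` iterations
    -- each add `G.eval S`; `W` bounds the cost of guard, body and counter update of one iteration.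
    set W : ℕ[X] := (1 + C K₁ * X) + (1 + T) + (1 + 2 + C K₂ * X) with hW
    set V : ℕ[X] := X + X * G with hV
    refine ⟨X * G, 7 + (X + 1) * W.comp V, fun S m σ n hS hm hn hnS h0 hσ => ?_⟩
    have hb : ∀ r ≤ n, iter i p.run σ r 0 = σ 0 ∧
        (iter i p.run σ r).Bounded (m + r * G.eval S) := by
      intro r
      induction r with
      | zero =>
        exact fun _ => ⟨Store.write_ne _ _ _ (Ne.symm hi),
          by simpa [iter] using hσ.write (x := i) (k := 0) (v := 0) (by simp)⟩
      | succ r ihr =>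
        intro hr
        obtain ⟨hz, hbr⟩ := ihr (by omega)
        refine ⟨?_, ?_⟩
        · rw [iter, Store.write_ne _ _ _ (Ne.symm hi), run_zero hp, hz]
        · have := (h S (m + r * G.eval S) _ n hS (by omega) (by rw [hz, hn]) hnS
            (by rwa [hz]) hbr).2
          rw [show m + (r + 1) * G.eval S = m + r * G.eval S + G.eval S by ring]
          refine this.write ?_
          have h1 : ((r : ℤ) + 1).natAbs = r + 1 := by omega
          rw [h1]
          exact (Nat.lt_two_pow_self (n := r + 1)).le.trans
            (Nat.pow_le_pow_right (by norm_num) (by omega))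
    have hVm : ∀ r ≤ n, m + r * G.eval S ≤ V.eval m := by
      intro r hr
      have := eval_mono_of_nat G hm
      simp only at this
      simp only [hV, eval_add, eval_X, eval_mul]
      have : r * G.eval S ≤ m * G.eval m := Nat.mul_le_mul (by omega) this
      omega
    have hloop : ∀ d r, r + d = n → ∃ t, Exec (.loop (.sub (.get 0 (.const 1)) (.get i (.const 0)))
        (.seq p.compile (.assign i (.const 0) (.add (.get i (.const 0)) (.const 1)))))
        (iter i p.run σ r) t (iter i p.run σ n) ∧ t ≤ (d + 1) * W.eval (V.eval m) := by
      intro d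
      induction d with
      | zero =>
        rintro r rfl
        obtain ⟨hz, hbr⟩ := hb r le_rfl
        refine ⟨_, .loop_neg ?_, ?_⟩
        · simp only [Expr.eval, hz, hn, iter_counter]; simp
        · have := (h₁ _ (V.eval m) (by simp only [hV, eval_add, eval_X]; omega)
            (hbr.mono (hVm r le_rfl))).2
          simp only [hW, eval_add, eval_one, eval_mul, eval_C, eval_X]
          omega
      | succ d ihd =>
        intro r hr
        obtain ⟨t', e', b'⟩ := ihd (r + 1) (by omega)
        obtain ⟨hz, hbr⟩ := hb r (by omega)
        have hVr := hVm r (by omega)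
        have hV1 : 1 ≤ V.eval m := by simp only [hV, eval_add, eval_X]; omega
        obtain ⟨⟨t, e, b⟩, B⟩ := h S (m + r * G.eval S) _ n hS (by omega) (by rw [hz, hn]) hnS
            (by rwa [hz]) hbr
        have hcnt : p.run (iter i p.run σ r) i 0 = r := by
          rw [run_of_notMem p hip, iter_counter]
        have e₂ : Exec (.assign i (.const 0) (.add (.get i (.const 0)) (.const 1)))
            (p.run (iter i p.run σ r)) (1 + (Expr.const 0).cost (p.run (iter i p.run σ r)) +
              (Expr.add (.get i (.const 0)) (.const 1)).cost (p.run (iter i p.run σ r)))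
            (iter i p.run σ (r + 1)) := by
          have := Exec.assign (p.run (iter i p.run σ r)) i (.const 0)
            (.add (.get i (.const 0)) (.const 1))
          simpa only [Expr.eval, hcnt, iter] using this
        refine ⟨_, .loop_pos ?_ (.seq e e₂) e', ?_⟩
        · simp only [Expr.eval, hz, hn, iter_counter]; omega
        · have c1 := (h₁ _ (V.eval m) hV1 (hbr.mono hVr)).2
          have c2 := (h₂ _ (V.eval m) hV1 (B.mono (m' := V.eval m) (by
            have := hVm (r + 1) (by omega)
            rw [add_mul, one_mul] at this; omega))).2
          have c3 : T.eval (m + r * G.eval S) ≤ T.eval (V.eval m) := eval_mono_of_nat T hVr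
          have c4 : (Expr.const 0).cost (p.run (iter i p.run σ r)) = 1 := by
            simp [Expr.cost, bitCost]
          have key : W.eval (V.eval m) = (1 + K₁ * V.eval m) + (1 + T.eval (V.eval m)) +
              (1 + 2 + K₂ * V.eval m) := by simp [hW]
          rw [add_mul (d + 1), one_mul]
          omega
    obtain ⟨t, e, b⟩ := hloop n 0 (by omega)
    have hrun : run (forN i p) σ = iter i p.run σ n := by simp [run, hn]
    rw [hrun]
    refine ⟨⟨_, .seq (Exec.assign σ i (.const 0) (.const 0)) e, ?_⟩, ?_⟩
    · have : (n + 1) * W.eval (V.eval m) ≤ (m + 1) * W.eval (V.eval m) :=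
        Nat.mul_le_mul_right _ (by omega)
      have c4 : (Expr.const 0).cost σ = 1 := by simp [Expr.cost, bitCost]
      have key : eval m (7 + (X + 1) * W.comp V) = 7 + (m + 1) * W.eval (V.eval m) := by
        simp [eval_comp]
      rw [key, c4]
      omega
    · refine (hb n le_rfl).2.mono ?_
      simp only [eval_mul, eval_X]
      have := Nat.mul_le_mul_right (G.eval S) hnS
      omega

end HouseAllocation

namespace HouseAllocation

/-! ## The algorithm

The arrays used by the algorithm; scalars are kept in cell `0` of their array. -/

/-- The house of each agent. -/
local notation "Alloc" => 2
/-- The price of each house. -/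
local notation "Price" => 3
/-- The integral utilities, row by row. -/
local notation "Util" => 4
/-- The agents reached by the current tree. -/
local notation "Mark" => 5
/-- The parents in the current tree. -/
local notation "Par" => 6
/-- The subsidies of the agents. -/
local notation "Subs" => 7
/-- The common denominator. -/
local notation "Denom" => 8
/-- Accumulator for products. -/
local notation "Acc" => 9
/-- The root of the current tree. -/
local notation "Root" => 10
local notation "CtrA" => 11
local notation "CtrB" => 12
local notation "CtrC" => 13
local notation "CtrT" => 14
/-- Whether an edge entering the tree was found, its slack, its tail and its head. -/
local notation "Found" => 15
local notation "Best" => 16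
local notation "Tail" => 17
local notation "Head" => 18
/-- The end of the path along which houses are exchanged, and a temporary variable. -/
local notation "Cur" => 19
local notation "Tmp" => 20

namespace Expr

instance : Add Expr := ⟨Expr.add⟩
instance : Sub Expr := ⟨Expr.sub⟩
instance : Mul Expr := ⟨Expr.mul⟩

/-- The scalar variable stored in array `x`. -/
def var (x : ℕ) : Expr := .get x (.const 0)

/-- The number of agents. -/
def size : Expr := .get 0 (.const 1)

variable (σ : Store) (e f : Expr)

theorem eval_add' : (e + f).eval σ = e.eval σ + f.eval σ := rfl
theorem eval_sub' : (e - f).eval σ = e.eval σ - f.eval σ := rfl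
theorem eval_mul' : (e * f).eval σ = e.eval σ * f.eval σ := rfl
theorem eval_var (x : ℕ) : (var x).eval σ = σ x 0 := rfl
theorem eval_size : size.eval σ = σ 0 1 := rfl
theorem eval_const (z : ℤ) : (const z).eval σ = z := rfl
theorem eval_get (x : ℕ) : (get x e).eval σ = σ x (e.eval σ) := rfl

end Expr

open HouseAllocation.Expr

local infixr:60 " ;; " => Cmd.seq

namespace Cmd

/-- Assignment to a scalar variable. -/
def put (x : ℕ) (e : Expr) : Cmd := .assign x (.const 0) e

theorem run_put (x : ℕ) (e : Expr) (σ : Store) : (put x e).run σ = σ.write x 0 (e.eval σ) := rfl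
theorem run_assign (x : ℕ) (e f : Expr) (σ : Store) :
    (assign x e f).run σ = σ.write x (e.eval σ) (f.eval σ) := rfl
theorem run_seq (p q : Cmd) (σ : Store) : (p.seq q).run σ = q.run (p.run σ) := rfl
theorem run_ite (e : Expr) (p q : Cmd) (σ : Store) :
    (ite e p q).run σ = if 0 < e.eval σ then p.run σ else q.run σ := rfl
theorem run_skip (σ : Store) : skip.run σ = σ := rfl

end Cmd

open HouseAllocation.Cmd

/-! ### Commands that grow a tree of tight edges. -/

/-- The utility of agent `i` for the house of agent `j`. -/
def utilE (i j : Expr) : Expr := .get Util (i * size + .get Alloc j)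

/-- The amount by which agent `i` prefers her own bundle to that of agent `j`. -/
def slackE (i j : Expr) : Expr :=
  utilE i i + .get Price (.get Alloc i) - utilE i j - .get Price (.get Alloc j)

def recordEdge : Cmd :=
  put Best (slackE (var CtrA) (var CtrB)) ;; put Tail (var CtrA) ;; put Head (var CtrB) ;;
    put Found (.const 1)

/-- Guards only test positivity, so `1 - x` serves as the negation of a flag `x`. The edge is
recorded if it is the first to enter the tree or strictly better than the recorded one. -/
def testEdge : Cmd :=
  .ite (.const 1 - .get Mark (var CtrA))
    (.ite (.get Mark (var CtrB))
      (.ite (.const 1 - var Found) recordEdge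
        (.ite (var Best - slackE (var CtrA) (var CtrB)) recordEdge .skip)) .skip) .skip

/-- Finds an edge of minimum slack from an unmarked to a marked agent. -/
def searchEdge : Cmd := put Found (.const 0) ;; .forN CtrA (.forN CtrB testEdge)

/-- Lowers the prices of the houses of the unmarked agents. -/
def lowerPrices : Cmd :=
  .forN CtrA (.ite (.const 1 - .get Mark (var CtrA))
    (.assign Price (.get Alloc (var CtrA)) (.get Price (.get Alloc (var CtrA)) - var Best)) .skip)

/-- Adds one agent to the tree. -/
def extendTree : Cmd :=
  searchEdge ;; .ite (var Found)
    (lowerPrices ;; .assign Mark (var Tail) (.const 1) ;; .assign Par (var Tail) (var Head)) .skip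

/-- Grows a spanning tree of tight edges directed towards the root. -/
def growTree : Cmd :=
  .forN CtrA (.assign Mark (var CtrA) (.const 0)) ;; .assign Mark (var Root) (.const 1) ;;
    .forN CtrT extendTree

/-! ### Search -/

/-- The utilities of the agents for the houses of the agents, as stored in `σ`. -/
def weight (σ : Store) (n : ℕ) (i j : ℤ) : ℤ := σ Util (i * n + σ Alloc j)

/-- The prices of the houses of the agents, as stored in `σ`. -/
def price (σ : Store) (j : ℤ) : ℤ := σ Price (σ Alloc j)

/-- The amount by which agent `i` prefers her own bundle to that of agent `j`. -/
def slack (w : ℤ → ℤ → ℤ) (P : ℤ → ℤ) (i j : ℤ) : ℤ := w i i + P i - w i j - P j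

theorem eval_slackE {σ : Store} {n : ℕ} (hn : σ 0 1 = n) (i j : Expr) :
    (slackE i j).eval σ = slack (weight σ n) (price σ) (i.eval σ) (j.eval σ) := by
  simp only [slackE, utilE, eval_sub', eval_add', eval_get, eval_mul', eval_size, hn, slack,
    weight, price]

/-- The edge `(x, y)` of slack `b` has minimum slack among the edges in `S` that enter the set
where `T` is positive, and `f` tells whether there is such an edge. -/
def IsBestEdge (w : ℤ → ℤ → ℤ) (P T : ℤ → ℤ) (S : ℤ → ℤ → Prop) (f b x y : ℤ) : Prop :=
  (f = 0 ∧ ∀ i j, S i j → T i ≤ 0 → ¬ 0 < T j) ∨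
    (f = 1 ∧ S x y ∧ T x ≤ 0 ∧ 0 < T y ∧ b = slack w P x y ∧
      ∀ i j, S i j → T i ≤ 0 → 0 < T j → b ≤ slack w P i j)

/-- `IsBestEdge` for the edge stored in `τ`. -/
def HoldsBestEdge (w : ℤ → ℤ → ℤ) (P T : ℤ → ℤ) (S : ℤ → ℤ → Prop) (τ : Store) : Prop :=
  IsBestEdge w P T S (τ Found 0) (τ Best 0) (τ Tail 0) (τ Head 0)

theorem HoldsBestEdge.write {w : ℤ → ℤ → ℤ} {P T : ℤ → ℤ} {S S' : ℤ → ℤ → Prop} {τ : Store}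
    (h : HoldsBestEdge w P T S τ) (hS : ∀ i j, S i j ↔ S' i j) {x : ℕ} (hx : x < Found) (k v : ℤ) :
    HoldsBestEdge w P T S' (τ.write x k v) := by
  have : S = S' := funext fun i => funext fun j => propext (hS i j)
  subst this
  unfold HoldsBestEdge
  rwa [Store.write_ne, Store.write_ne, Store.write_ne, Store.write_ne] <;> omega

/-- One step of a running minimum: `S` holds the edges scanned before, and `S'` adds at most the
current one. -/
theorem testEdge_spec {w : ℤ → ℤ → ℤ} {P T : ℤ → ℤ} {S S' : ℤ → ℤ → Prop} {τ : Store} {n : ℕ}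
    (hn : τ 0 1 = n) (hw : weight τ n = w) (hP : price τ = P) (hT : τ Mark = T)
    (h : HoldsBestEdge w P T S τ) (hS : ∀ i j, S i j → S' i j) (hS0 : S' (τ CtrA 0) (τ CtrB 0))
    (hS' : ∀ i j, S' i j → S i j ∨ (i = τ CtrA 0 ∧ j = τ CtrB 0)) :
    HoldsBestEdge w P T S' (testEdge.run τ) := by
  have hrec : T (τ CtrA 0) ≤ 0 → 0 < T (τ CtrB 0) →
      (∀ i j, S i j → T i ≤ 0 → 0 < T j → slack w P (τ CtrA 0) (τ CtrB 0) ≤ slack w P i j) →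
      HoldsBestEdge w P T S' (recordEdge.run τ) := by
    intro h1 h2 h3
    simp only [HoldsBestEdge, recordEdge, run_seq, run_put, Store.write_same, eval_slackE hn,
      eval_var, eval_const, hw, hP]
    simp only [Store.write_ne, ne_eq, Nat.reduceEqDiff, not_false_eq_true,
      Store.write_same, if_true]
    refine Or.inr ⟨rfl, hS0, h1, h2, rfl, fun i j hij hi hj => ?_⟩
    rcases hS' i j hij with h | ⟨rfl, rfl⟩
    exacts [h3 i j h hi hj, le_rfl]
  have hskip : (T (τ CtrA 0) ≤ 0 → 0 < T (τ CtrB 0) →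
      τ Found 0 ≠ 0 ∧ τ Best 0 ≤ slack w P (τ CtrA 0) (τ CtrB 0)) →
      HoldsBestEdge w P T S' τ := by
    intro h1
    rcases h with ⟨hf, h⟩ | ⟨hf, hxy, hx, hy, hb, h⟩
    · refine Or.inl ⟨hf, fun i j hij hi hj => ?_⟩
      rcases hS' i j hij with h' | ⟨rfl, rfl⟩
      exacts [h i j h' hi hj, (h1 hi hj).1 hf]
    · refine Or.inr ⟨hf, hS _ _ hxy, hx, hy, hb, fun i j hij hi hj => ?_⟩
      rcases hS' i j hij with h' | ⟨rfl, rfl⟩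
      exacts [h i j h' hi hj, (h1 hi hj).2]
  simp only [testEdge, run_ite, run_skip, eval_sub', eval_const, eval_get, eval_var, hT,
    eval_slackE hn, hw, hP]
  split_ifs with h1 h2 h3 h4
  · refine hrec (by omega) h2 fun i j hij hi hj => ?_
    rcases h with ⟨hf, h⟩ | ⟨hf, _⟩
    exacts [absurd hj (h i j hij hi), by omega]
  · refine hrec (by omega) h2 fun i j hij hi hj => ?_
    rcases h with ⟨hf, h⟩ | ⟨hf, _, _, _, _, h⟩
    exacts [absurd hj (h i j hij hi), by have := h i j hij hi hj; omega]
  · exact hskip fun _ _ => ⟨by omega, by omega⟩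
  · exact hskip fun _ h => absurd h h2
  · exact hskip fun h _ => by omega

theorem searchEdge_spec {σ : Store} {n : ℕ} (hn : σ 0 1 = n) :
    HoldsBestEdge (weight σ n) (price σ) (σ Mark) (fun i j => (0 ≤ i ∧ i < n) ∧ 0 ≤ j ∧ j < n)
      (searchEdge.run σ) := by
  rw [searchEdge, run_seq]
  set σ' := (put Found (.const 0)).run σ with hσ'
  have hf0 : ∀ y, y ≠ Found → σ' y = σ y := fun y hy => Store.write_ne _ _ _ hy
  have hff : σ' Found 0 = 0 := by simp [hσ', run_put, Store.write_same, eval_const]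
  refine forN_induction (n := n) (by rw [hf0 0 (by decide), hn])
    (I := fun r τ => HoldsBestEdge (weight σ n) (price σ) (σ Mark)
      (fun i j => (0 ≤ i ∧ i < r) ∧ 0 ≤ j ∧ j < n) τ) ?_ fun r τ hr hc hf h => ?_
  · refine Or.inl ⟨?_, fun i j hij => by simp only [Nat.cast_zero] at hij; omega⟩
    rw [Store.write_ne _ _ _ (by decide), hff]
  · have hf' : ∀ y, y ∉ Found :: CtrA :: (forN CtrB testEdge).writes → τ y = σ y := by
      intro y hy
      rw [List.mem_cons, not_or] at hy
      rw [hf y hy.2, hf0 y hy.1]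
    -- While row `r` is scanned, the edges seen are all earlier rows and an initial segment of row
    -- `r`.
    have key : HoldsBestEdge (weight σ n) (price σ) (σ Mark)
        (fun i j => ((0 ≤ i ∧ i < r) ∧ 0 ≤ j ∧ j < n) ∨ (i = r ∧ 0 ≤ j ∧ j < n))
        ((forN CtrB testEdge).run τ) := by
      refine forN_induction (n := n) (by rw [hf' 0 (by decide), hn])
        (I := fun q τ => HoldsBestEdge (weight σ n) (price σ) (σ Mark)
        (fun i j => ((0 ≤ i ∧ i < r) ∧ 0 ≤ j ∧ j < n) ∨ (i = r ∧ 0 ≤ j ∧ j < q)) τ)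
        ?_ fun q ρ hq hcq hfq hI => ?_
      · exact h.write (by intro i j; push_cast; omega) (by decide) _ _
      · have e : ∀ y, y ∉ Found :: CtrA :: CtrB :: testEdge.writes → ρ y = σ y := by
          intro y hy
          rw [hfq y (by simp only [List.mem_cons, not_or] at hy ⊢; tauto),
            hf' y (by simpa [writes, or_assoc] using hy)]
        have hA : ρ CtrA 0 = r := by rw [hfq CtrA (by decide), hc]
        have := testEdge_spec (S' := fun i j => ((0 ≤ i ∧ i < r) ∧ 0 ≤ j ∧ j < n) ∨
          (i = r ∧ 0 ≤ j ∧ j < (q + 1 : ℕ))) (τ := ρ) (by rw [e 0 (by decide), hn])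
          (by unfold weight; rw [e Util (by decide), e Alloc (by decide)])
          (by unfold price; rw [e Price (by decide), e Alloc (by decide)])
          (e Mark (by decide)) hI (by intro i j; push_cast; omega)
          (by rw [hA, hcq]; push_cast; omega) (by rw [hA, hcq]; intro i j; push_cast; omega)
        exact this.write (fun _ _ => Iff.rfl) (by decide) _ _
    exact key.write (by intro i j; push_cast; omega) (by decide) _ _

/-! ### Trees of tight edges -/

/-- The loop runs over agents while prices belong to houses; injectivity of the allocation ensures
that no price is lowered twice. -/
theorem lowerPrices_spec {σ : Store} {n : ℕ} (hn : σ 0 1 = n)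
    (ha : Set.InjOn (σ Alloc) (Set.Ico 0 n)) (j : ℤ) (hj : 0 ≤ j ∧ j < n) :
    price (lowerPrices.run σ) j =
      if σ Mark j ≤ 0 then price σ j - σ Best 0 else price σ j := by
  have key : ∀ j : ℤ, 0 ≤ j → j < n → (lowerPrices.run σ) Price (σ Alloc j) =
      if j < n ∧ σ Mark j ≤ 0 then price σ j - σ Best 0 else price σ j := by
    refine forN_induction (n := n) hn (I := fun r τ => ∀ j : ℤ, 0 ≤ j → j < n →
      τ Price (σ Alloc j) = if j < r ∧ σ Mark j ≤ 0 then price σ j - σ Best 0 else price σ j)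
      (fun j h0 h1 => ?_) fun r τ hr hc hf h j h0 h1 => ?_
    · rw [Store.write_ne _ _ _ (by decide), if_neg (by push_cast; omega)]; rfl
    · rw [Store.write_ne _ _ _ (by decide)]
      have hlt : (j < ((r + 1 : ℕ) : ℤ) ∧ σ Mark j ≤ 0) ↔
          (j = r ∧ σ Mark r ≤ 0) ∨ (j < (r : ℤ) ∧ σ Mark j ≤ 0) := by
        push_cast
        by_cases hjr : j = r
        · subst hjr; omega
        · omega
      have hinj : σ Alloc j = σ Alloc r ↔ j = r :=
        ha.eq_iff ⟨h0, h1⟩ ⟨by omega, by omega⟩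
      have hjr := h j h0 h1
      have hrr := h r (by omega) (by omega)
      rw [if_neg (by omega)] at hrr
      rw [if_congr hlt rfl rfl, run_ite]
      simp only [eval_sub', eval_const, eval_get, eval_var, hc, hf Mark (by decide)]
      split_ifs with h2 h3 h3 <;>
        simp only [run_assign, run_skip, eval_sub', eval_get, eval_var, hc, Store.write_same,
          hf Alloc (by decide), hf Best (by decide), hinj]
      · split_ifs with h4
        · rw [hrr, h4]
        · rw [hjr, if_pos (by omega)]
      · rw [if_neg (by omega), hjr, if_neg (by omega)]
      · rw [hjr, if_pos (by omega)]
      · rw [hjr, if_neg (by omega)]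
  have ha' : (lowerPrices.run σ) Alloc = σ Alloc := run_of_notMem _ (by decide) σ
  rw [price, ha', key j hj.1 hj.2]
  simp [hj.2]

/-- The marked agents form a tree of tight edges directed towards `k` by `par`; `rk` decreases
along the edges. -/
structure IsTree (n : ℕ) (w : ℤ → ℤ → ℤ) (P T par : ℤ → ℤ) (k : ℤ) (rk : ℤ → ℕ) (t : ℕ) :
    Prop where
  mark : ∀ j : ℤ, 0 ≤ j ∧ j < n → T j = 0 ∨ T j = 1
  root : T k = 1
  rank : ∀ j : ℤ, 0 ≤ j ∧ j < n → T j = 1 → rk j ≤ t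
  edge : ∀ j : ℤ, 0 ≤ j ∧ j < n → T j = 1 → j ≠ k →
    (0 ≤ par j ∧ par j < n) ∧ T (par j) = 1 ∧ rk (par j) < rk j ∧ slack w P j (par j) = 0

/-- All agents satisfying `C` find their bundle at least as good as those of the others. -/
def IsFeasible (n : ℕ) (w : ℤ → ℤ → ℤ) (P : ℤ → ℤ) (C : ℤ → Prop) : Prop :=
  ∀ j : ℤ, 0 ≤ j ∧ j < n → C j → ∀ i : ℤ, 0 ≤ i ∧ i < n → 0 ≤ slack w P j i

section extend

variable {n : ℕ} {w : ℤ → ℤ → ℤ} {P P' T par : ℤ → ℤ} {k : ℤ} {rk : ℤ → ℕ} {t : ℕ} {b x y : ℤ}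

/-- Old tree edges have both ends marked, so their slack is unchanged. The new edge has slack `b`
and loses exactly `b`, as only its tail is repriced. The rank `t + 1` exceeds all ranks in the tree.
-/
theorem IsTree.extend (h : IsTree n w P T par k rk t) (hx : 0 ≤ x ∧ x < n) (hy : 0 ≤ y ∧ y < n)
    (hTx : T x ≤ 0) (hTy : 0 < T y) (hb : b = slack w P x y)
    (hP : ∀ j : ℤ, 0 ≤ j ∧ j < n → P' j = if T j ≤ 0 then P j - b else P j) :
    IsTree n w P' (Function.update T x 1) (Function.update par x y) k
      (Function.update rk x (t + 1)) (t + 1) := by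
  have hk : k ≠ x := by rintro rfl; have := h.root; omega
  have hyx : y ≠ x := by rintro rfl; omega
  have hTy' : T y = 1 := by have := h.mark y hy; omega
  refine ⟨fun j hj => ?_, ?_, fun j hj hT => ?_, fun j hj hT hjk => ?_⟩
  · by_cases hjx : j = x
    · simp [hjx]
    · simpa [hjx] using h.mark j hj
  · simpa [hk] using h.root
  · by_cases hjx : j = x
    · simp [hjx]
    · simp only [Function.update_of_ne hjx] at hT ⊢
      exact (h.rank j hj hT).trans (Nat.le_succ t)
  · by_cases hjx : j = x
    · subst hjx
      simp only [Function.update_self, Function.update_of_ne hyx]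
      refine ⟨hy, hTy', by have := h.rank y hy hTy'; omega, ?_⟩
      rw [slack] at hb ⊢
      rw [hP j hj, hP y hy, if_pos hTx, if_neg (by omega)]
      omega
    · simp only [Function.update_of_ne hjx] at hT ⊢
      obtain ⟨h1, h2, h3, h4⟩ := h.edge j hj hT hjk
      have hpx : par j ≠ x := by intro e; rw [e] at h2; omega
      simp only [Function.update_of_ne hpx]
      refine ⟨h1, h2, h3, ?_⟩
      rw [slack] at h4 ⊢
      rw [hP j hj, hP _ h1, if_neg (by omega), if_neg (by omega)]
      exact h4

/-- The only slacks that shrink are those from unmarked to marked agents. They shrink by `b`, which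
is at most their value. -/
theorem IsFeasible.lower {C : ℤ → Prop} (h : IsFeasible n w P C) (hb0 : 0 ≤ b)
    (hb : ∀ i j : ℤ, (0 ≤ i ∧ i < n) ∧ 0 ≤ j ∧ j < n → T i ≤ 0 → 0 < T j → b ≤ slack w P i j)
    (hP : ∀ j : ℤ, 0 ≤ j ∧ j < n → P' j = if T j ≤ 0 then P j - b else P j) :
    IsFeasible n w P' C := by
  intro j hj hC i hi
  have h1 := h j hj hC i hi
  have h2 := hb j i ⟨hj, hi⟩
  rw [slack] at h1 h2 ⊢
  rw [hP j hj, hP i hi]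
  split_ifs <;> omega

end extend

/-- The tree grown from the root `k` after `t` steps. -/
def HoldsTree (n : ℕ) (w : ℤ → ℤ → ℤ) (k : ℤ) (C : ℤ → Prop) (t : ℕ) (τ : Store) : Prop :=
  (∃ rk, IsTree n w (price τ) (τ Mark) (τ Par) k rk t) ∧ IsFeasible n w (price τ) C ∧
    (t < ((Finset.Ico (0 : ℤ) n).filter fun j => τ Mark j = 1).card ∨
      ∀ j : ℤ, 0 ≤ j ∧ j < n → τ Mark j = 1)

theorem extendTree_spec {τ : Store} {n : ℕ} {w : ℤ → ℤ → ℤ} {k : ℤ} {C : ℤ → Prop} {t : ℕ}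
    (hn : τ 0 1 = n) (ha : Set.InjOn (τ Alloc) (Set.Ico 0 n)) (hk : 0 ≤ k ∧ k < n)
    (hC : ∀ j, j ≠ k → C j) (hw : weight τ n = w) (h : HoldsTree n w k C t τ) :
    HoldsTree n w k C (t + 1) (extendTree.run τ) := by
  obtain ⟨⟨rk, htree⟩, hfeas, hcard⟩ := h
  have hs := searchEdge_spec hn
  rw [extendTree, run_seq, run_ite]
  set ρ := searchEdge.run τ with hρ
  have hf : ∀ y, y ∉ searchEdge.writes → ρ y = τ y := fun y hy => run_of_notMem _ hy τ
  have hM : ρ Mark = τ Mark := hf _ (by decide)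
  have hP : price ρ = price τ := by unfold price; rw [hf Alloc (by decide), hf Price (by decide)]
  rw [eval_var]
  rw [hw] at hs
  rcases hs with ⟨hF, h⟩ | ⟨hF, ⟨hx, hy⟩, hTx, hTy, hb, h⟩
  · rw [if_neg (by omega), run_skip]
    refine ⟨⟨rk, ?_⟩, by rwa [hP], Or.inr fun j hj => ?_⟩
    · rw [hP, hM, hf Par (by decide)]
      exact ⟨htree.mark, htree.root, fun j hj hT => (htree.rank j hj hT).trans (Nat.le_succ t),
        htree.edge⟩
    · rw [hM]
      by_contra hT
      have := htree.mark j hj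
      -- An unmarked `j` would give the entering edge from `j` to the root.
      exact h j k ⟨hj, hk⟩ (by omega) (by rw [htree.root]; norm_num)
  · rw [if_pos (by omega)]
    simp only [run_seq, run_assign, eval_var, eval_const]
    have hP' := lowerPrices_spec (σ := ρ) (by rw [hf 0 (by decide), hn])
      (by rwa [hf Alloc (by decide)])
    set υ := lowerPrices.run ρ with hυ
    have hfυ : ∀ y, y ∉ lowerPrices.writes → υ y = ρ y := fun y hy => run_of_notMem _ hy ρ
    rw [hP, hM] at hP'
    set x := ρ Tail 0
    set y := ρ Head 0
    have e1 : υ Tail 0 = x := by rw [hfυ _ (by decide)]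
    have e2 : υ Head 0 = y := by rw [hfυ _ (by decide)]
    rw [e1, Store.write_ne (y := Tail) _ _ _ (by decide), Store.write_ne (y := Head) _ _ _ (by decide),
      e1, e2]
    set φ := (υ.write Mark x 1).write Par x y with hφ
    have hφM : φ Mark = Function.update (τ Mark) x 1 := by
      rw [hφ, Store.write_ne _ _ _ (by decide)]
      funext l
      rw [Store.write_same, Function.update_apply, hfυ _ (by decide), hM]
    have hφP : φ Par = Function.update (τ Par) x y := by
      funext l
      rw [hφ, Store.write_same, Function.update_apply, Store.write_ne _ _ _ (by decide),
        hfυ _ (by decide), hf _ (by decide)]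
    have hφp : price φ = price υ := by
      unfold price
      rw [hφ]
      simp only [Store.write_ne, ne_eq, Nat.reduceEqDiff, not_false_eq_true]
    have hxk : x ≠ k := by intro e; rw [e, htree.root] at hTx; omega
    refine ⟨⟨Function.update rk x (t + 1), ?_⟩, ?_, ?_⟩
    · rw [hφp, hφM, hφP]
      exact htree.extend hx hy hTx hTy hb hP'
    · rw [hφp]
      -- The tail is unmarked, hence not the root; so its slack is nonnegative even when the root is
      -- exempt from feasibility.
      refine hfeas.lower ?_ h hP'
      rw [hb]
      exact hfeas x hx (hC x hxk) y hy
    · left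
      rcases hcard with hcard | hall
      · refine lt_of_le_of_lt (Nat.succ_le_of_lt hcard) (Finset.card_lt_card ?_)
        rw [Finset.ssubset_iff_of_subset]
        · refine ⟨x, ?_, ?_⟩
          · simp [hφM, hx.1, hx.2]
          · simp only [Finset.mem_filter, not_and]; intro _; omega
        · intro j
          simp only [Finset.mem_filter, hφM, Function.update_apply]
          rintro ⟨h1, h2⟩
          exact ⟨h1, by split_ifs; exacts [rfl, h2]⟩
      · have := hall x hx; omega

/-- Only agents outside the tree ever need nonnegative slacks, so the root may be exempt. Insertion
uses this with `C` excluding the root; the computation of subsidies takes `C` to hold for all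
agents. -/
theorem growTree_spec {σ : Store} {n : ℕ} {w : ℤ → ℤ → ℤ} {C : ℤ → Prop}
    (hn : σ 0 1 = n) (ha : Set.InjOn (σ Alloc) (Set.Ico 0 n))
    (hk : 0 ≤ σ Root 0 ∧ σ Root 0 < n) (hC : ∀ j, j ≠ σ Root 0 → C j) (hw : weight σ n = w)
    (hfeas : IsFeasible n w (price σ) C) :
    IsFeasible n w (price (growTree.run σ)) C ∧ ∃ rk : ℤ → ℕ,
      (∀ j : ℤ, 0 ≤ j ∧ j < n → rk j ≤ n) ∧
      ∀ j : ℤ, 0 ≤ j ∧ j < n → j ≠ σ Root 0 →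
        (0 ≤ (growTree.run σ) Par j ∧ (growTree.run σ) Par j < n) ∧
        rk ((growTree.run σ) Par j) < rk j ∧
        slack w (price (growTree.run σ)) j ((growTree.run σ) Par j) = 0 := by
  set k := σ Root 0 with hk0
  have hclear : ∀ j : ℤ, 0 ≤ j → j < n →
      (forN CtrA (.assign Mark (var CtrA) (.const 0))).run σ Mark j = 0 := by
    refine forN_induction (n := n) hn (I := fun r τ => ∀ j : ℤ, 0 ≤ j → j < r → τ Mark j = 0)
      (fun j h0 h1 => by push_cast at h1; omega) fun r τ hr hc hf h j h0 h1 => ?_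
    rw [Store.write_ne _ _ _ (by decide), run_assign, Store.write_same, eval_var, hc, eval_const]
    split_ifs with hj
    · rfl
    · exact h j h0 (by push_cast at h1; omega)
  suffices H : HoldsTree n w k C n (growTree.run σ) by
    obtain ⟨⟨rk, ht⟩, hF, hcard⟩ := H
    have hall : ∀ j : ℤ, 0 ≤ j ∧ j < n → (growTree.run σ) Mark j = 1 := by
      rcases hcard with h | h
      -- After `n` steps the first alternative would mark more than `n` of `n` agents.
      · have := h.trans_le (Finset.card_filter_le _ _)
        simp at this
      · exact h
    refine ⟨hF, rk, fun j hj => ht.rank j hj (hall j hj), fun j hj hjk => ?_⟩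
    obtain ⟨h1, _, h3, h4⟩ := ht.edge j hj (hall j hj) hjk
    exact ⟨h1, h3, h4⟩
  rw [growTree, run_seq, run_seq]
  set υ := (forN CtrA (.assign Mark (var CtrA) (.const 0))).run σ with hυ
  have hfυ : ∀ y, y ≠ Mark → y ≠ CtrA → υ y = σ y := fun y h1 h2 =>
    run_of_notMem _ (by simp [writes, h1, h2]) σ
  rw [run_assign, eval_var, eval_const, hfυ Root (by decide) (by decide), ← hk0]
  have hfφ : ∀ y, y ≠ Mark → y ≠ CtrA → (υ.write Mark k 1) y = σ y := fun y h1 h2 => by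
    rw [Store.write_ne _ _ _ h1, hfυ y h1 h2]
  set φ := υ.write Mark k 1 with hφ
  have hM : ∀ j : ℤ, 0 ≤ j ∧ j < n → φ Mark j = if j = k then 1 else 0 := fun j hj => by
    rw [hφ, Store.write_same, hclear j hj.1 hj.2]
  have hpφ : ∀ τ : Store, τ Price = φ Price → τ Alloc = φ Alloc → price τ = price σ := by
    intro τ h1 h2
    unfold price
    rw [h1, h2, hfφ _ (by decide) (by decide), hfφ _ (by decide) (by decide)]
  refine forN_induction (n := n) (by rw [hfφ 0 (by decide) (by decide), hn])
    (I := fun t τ => HoldsTree n w k C t τ) ?_ fun t τ hr hc hf h => ?_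
  · refine ⟨⟨fun _ => 0, ?_⟩, ?_, Or.inl ?_⟩
    · rw [Store.write_ne _ _ _ (by decide)]
      refine ⟨fun j hj => ?_, ?_, fun _ _ _ => le_rfl, fun j hj hT hjk => ?_⟩
      · rw [hM j hj]; split_ifs <;> simp
      · rw [hM k hk, if_pos rfl]
      · rw [hM j hj, if_neg hjk] at hT; omega
    · rwa [hpφ _ (Store.write_ne _ _ _ (by decide)) (Store.write_ne _ _ _ (by decide))]
    · rw [Finset.card_pos]
      refine ⟨k, ?_⟩
      rw [Finset.mem_filter, Store.write_ne _ _ _ (by decide), hM k hk, if_pos rfl]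
      exact ⟨by simp [hk.1, hk.2], rfl⟩
  · have e : ∀ y, y ∉ Mark :: CtrA :: CtrT :: extendTree.writes → τ y = σ y := by
      intro y hy
      simp only [List.mem_cons, not_or] at hy
      rw [hf y (by simp only [List.mem_cons, not_or]; tauto), hfφ y hy.1 hy.2.1]
    have := extendTree_spec (τ := τ) (by rw [e 0 (by decide), hn])
      (by rwa [e Alloc (by decide)]) hk hC
      (by rw [← hw]; unfold weight; rw [e Util (by decide), e Alloc (by decide)]) h
    obtain ⟨⟨rk, h1⟩, h2, h3⟩ := this
    have hp : price ((extendTree.run τ).write CtrT 0 ((t : ℤ) + 1)) =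
        price (extendTree.run τ) := by
      unfold price
      rw [Store.write_ne _ _ _ (by decide), Store.write_ne _ _ _ (by decide)]
    refine ⟨⟨rk, ?_⟩, ?_, ?_⟩
    · rw [hp, Store.write_ne _ _ _ (by decide), Store.write_ne _ _ _ (by decide)]; exact h1
    · rwa [hp]
    · rwa [Store.write_ne _ _ _ (by decide)]

/-! ### Scaling to integers -/

/-- The numerator of a utility in the input. -/
def numer (σ : Store) (n : ℕ) (i j : ℤ) : ℤ := σ 0 (3 + i * n + j)

/-- The denominator of a utility in the input. -/
def denom (σ : Store) (n : ℕ) (i j : ℤ) : ℤ := σ 0 (3 + n * n + i * n + j)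

def denomE (i j : Expr) : Expr := .get 0 (.const 3 + size * size + i * size + j)

/-- Computes the product of all denominators. -/
def multiplyDenoms : Cmd :=
  put Denom (.const 1) ;;
    .forN CtrB (.forN CtrC (put Denom (denomE (var CtrB) (var CtrC) * var Denom)))

/-- Computes the integral utilities of the agent given by the root. -/
def loadRow : Cmd :=
  .forN CtrA (put Acc (.get 0 (.const 3 + var Root * size + var CtrA)) ;;
    .forN CtrB (.forN CtrC
      (.ite ((var Root - var CtrB) * (var Root - var CtrB) +
          (var CtrA - var CtrC) * (var CtrA - var CtrC))
        (put Acc (denomE (var CtrB) (var CtrC) * var Acc)) .skip)) ;;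
    .assign Util (var Root * size + var CtrA) (var Acc))

theorem eval_denomE {σ : Store} {n : ℕ} (hn : σ 0 1 = n) (i j : Expr) :
    (denomE i j).eval σ = denom σ n (i.eval σ) (j.eval σ) := by
  simp only [denomE, eval_add', eval_get, eval_mul', eval_size, eval_const, hn, denom]

/-- A double loop multiplying a scalar by factors. -/
theorem run_product {x : ℕ} {c : Cmd} {σ : Store} {n : ℕ} (hn : σ 0 1 = n) {f : ℕ → ℕ → ℤ}
    (hx : x ≠ CtrB ∧ x ≠ CtrC) (hcw : CtrB ∉ c.writes) (h0 : 0 ∉ c.writes)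
    (hc : ∀ (τ : Store) (q r : ℕ), (∀ y, y ∉ CtrB :: CtrC :: c.writes → τ y = σ y) → q < n → r < n →
      τ CtrB 0 = q → τ CtrC 0 = r → (c.run τ) x 0 = f q r * τ x 0) :
    (forN CtrB (forN CtrC c)).run σ x 0 =
      (∏ q ∈ Finset.range n, ∏ r ∈ Finset.range n, f q r) * σ x 0 := by
  refine forN_induction (n := n) hn
    (I := fun k τ => τ x 0 = (∏ q ∈ Finset.range k, ∏ r ∈ Finset.range n, f q r) * σ x 0)
    (by rw [Store.write_ne _ _ _ hx.1]; simp) fun q τ hq hcq hf h => ?_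
  rw [Store.write_ne _ _ _ hx.1, Finset.prod_range_succ, mul_comm (∏ q ∈ Finset.range q, _),
    mul_assoc, ← h]
  refine forN_induction (n := n) ?_
    (I := fun k ρ => ρ x 0 = (∏ r ∈ Finset.range k, f q r) * τ x 0)
    (by rw [Store.write_ne _ _ _ hx.2]; simp) fun r ρ hr hcr hfr h => ?_
  · rw [hf 0 (by simp [writes, h0]), hn]
  · rw [Store.write_ne _ _ _ hx.2, hc ρ q r _ hq hr _ hcr, h, Finset.prod_range_succ]
    · ring
    · intro y hy
      simp only [List.mem_cons, not_or] at hy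
      rw [hfr y (by simp [hy]), hf y (by simp [writes, hy])]
    · rw [hfr CtrB (by simp [hcw]), hcq]

theorem multiplyDenoms_spec {σ : Store} {n : ℕ} (hn : σ 0 1 = n) :
    multiplyDenoms.run σ Denom 0 =
      ∏ q ∈ Finset.range n, ∏ r ∈ Finset.range n, denom σ n q r := by
  rw [multiplyDenoms, run_seq, run_put, run_product (n := n) (f := fun q r => denom σ n q r)
    _ (by decide) (by decide) (by decide)]
  · rw [Store.write_same, if_pos rfl, eval_const, mul_one]
  · intro τ q r hf hq hr h1 h2
    have e : τ 0 = σ 0 := by rw [hf 0 (by decide), Store.write_ne _ _ _ (by decide)]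
    rw [run_put, Store.write_same, if_pos rfl, eval_mul', eval_denomE (n := n) (by rw [e, hn]),
      eval_var, eval_var, eval_var, h1, h2, denom, e, denom]
  · rw [Store.write_ne _ _ _ (by decide), hn]

theorem index_injective {n : ℕ} {i j i' j' : ℤ} (hj : 0 ≤ j ∧ j < n) (hj' : 0 ≤ j' ∧ j' < n)
    (h : i * n + j = i' * n + j') : i = i' ∧ j = j' := by
  have hi : i = i' := by
    rcases lt_trichotomy i i' with h' | h' | h'
    · nlinarith
    · exact h'
    · nlinarith
  subst hi
  exact ⟨rfl, by linarith⟩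

/-- The machine has no division, so the product of denominators divided by one of them is computed
as a product omitting that factor. -/
theorem prod_ite_ne_mul {n k j : ℕ} (hk : k < n) (hj : j < n) (d : ℕ → ℕ → ℤ) :
    (∏ q ∈ Finset.range n, ∏ r ∈ Finset.range n, if q = k ∧ r = j then 1 else d q r) * d k j =
      ∏ q ∈ Finset.range n, ∏ r ∈ Finset.range n, d q r := by
  have h : d k j =
      ∏ q ∈ Finset.range n, ∏ r ∈ Finset.range n, if q = k ∧ r = j then d q r else 1 := by
    rw [Finset.prod_eq_single_of_mem k (Finset.mem_range.2 hk),
      Finset.prod_eq_single_of_mem j (Finset.mem_range.2 hj)]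
    · simp
    · intro r _ hr; simp [hr]
    · intro q _ hq; simp [hq]
  rw [h, ← Finset.prod_mul_distrib]
  refine Finset.prod_congr rfl fun q _ => ?_
  rw [← Finset.prod_mul_distrib]
  refine Finset.prod_congr rfl fun r _ => ?_
  split_ifs <;> simp

/-- The new entries are the utilities times the common denominator, in cross-multiplied form. That
other rows stay intact keeps the remaining agents envy-free. -/
theorem loadRow_spec {σ : Store} {n : ℕ} (hn : σ 0 1 = n)
    (hk : 0 ≤ σ Root 0 ∧ σ Root 0 < n) :
    (∀ j : ℤ, 0 ≤ j ∧ j < n → loadRow.run σ Util (σ Root 0 * n + j) * denom σ n (σ Root 0) j =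
      numer σ n (σ Root 0) j * ∏ q ∈ Finset.range n, ∏ r ∈ Finset.range n, denom σ n q r) ∧
    ∀ i j : ℤ, i ≠ σ Root 0 → 0 ≤ j ∧ j < n →
      loadRow.run σ Util (i * n + j) = σ Util (i * n + j) := by
  obtain ⟨k, hk'⟩ := Int.eq_ofNat_of_zero_le hk.1
  rw [hk'] at hk ⊢
  -- The second `j < n` is the loop bound `j < s` at `s = n`, so that the goal matches the
  -- invariant.
  have key : (∀ j : ℤ, 0 ≤ j ∧ j < n ∧ j < n → loadRow.run σ Util (k * n + j) * denom σ n k j =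
      numer σ n k j * ∏ q ∈ Finset.range n, ∏ r ∈ Finset.range n, denom σ n q r) ∧
    ∀ i j : ℤ, i ≠ k → 0 ≤ j ∧ j < n →
      loadRow.run σ Util (i * n + j) = σ Util (i * n + j) := by
    refine forN_induction (n := n) hn (I := fun s τ => (∀ j : ℤ, 0 ≤ j ∧ j < n ∧ j < s →
      τ Util (k * n + j) * denom σ n k j =
        numer σ n k j * ∏ q ∈ Finset.range n, ∏ r ∈ Finset.range n, denom σ n q r) ∧
      ∀ i j : ℤ, i ≠ k → 0 ≤ j ∧ j < n → τ Util (i * n + j) = σ Util (i * n + j))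
      ⟨fun j hj => by push_cast at hj; omega, fun i j _ _ => by
        rw [Store.write_ne _ _ _ (by decide)]⟩ fun s τ hs hcs hf h => ?_
    rw [Store.write_ne _ _ _ (by decide)]
    simp only [run_seq, run_assign, run_put]
    set υ := τ.write Acc 0 (eval τ (.get 0 (.const 3 + var Root * size + var CtrA))) with hυ
    have hυf : ∀ y, y ≠ Acc → υ y = τ y := fun y hy => Store.write_ne _ _ _ hy
    have e0 : υ 0 = σ 0 := by rw [hυf 0 (by decide), hf 0 (by decide)]
    have hprod := run_product (x := Acc) (c := .ite ((var Root - var CtrB) * (var Root - var CtrB) +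
          (var CtrA - var CtrC) * (var CtrA - var CtrC))
        (put Acc (denomE (var CtrB) (var CtrC) * var Acc)) .skip) (σ := υ) (n := n)
      (by rw [e0, hn]) (f := fun q r => if q = k ∧ r = s then 1 else denom σ n q r)
      (by decide) (by decide) (by decide) (by
        intro ρ q r hfρ hq hr h1 h2
        have e : ρ 0 = σ 0 := by rw [hfρ 0 (by decide), e0]
        have eA : ρ CtrA 0 = s := by rw [hfρ CtrA (by decide), hυf CtrA (by decide), hcs]
        have eR : ρ Root 0 = k := by
          rw [hfρ Root (by decide), hυf Root (by decide), hf Root (by decide), hk']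
        rw [run_ite]
        simp only [eval_add', eval_mul', eval_sub', eval_var, h1, h2, eA, eR]
        by_cases hqr : q = k ∧ r = s
        · obtain ⟨rfl, rfl⟩ := hqr
          simp [run_skip]
        -- A sum of two squares is positive exactly when the index pairs differ; this encodes the
        -- test as a positivity guard.
        · have hpos : 0 < ((k : ℤ) - q) * (k - q) + ((s : ℤ) - r) * (s - r) := by
            by_cases hqk : q = k
            · have : (s : ℤ) - r ≠ 0 := by omega
              have := mul_self_pos.2 this
              have := mul_self_nonneg ((k : ℤ) - q)
              omega
            · have : (k : ℤ) - q ≠ 0 := by omega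
              have := mul_self_pos.2 this
              have := mul_self_nonneg ((s : ℤ) - r)
              omega
          rw [if_pos hpos, if_neg hqr, run_put, Store.write_same, if_pos rfl, eval_mul',
            eval_denomE (n := n) (by rw [e, hn]), eval_var, eval_var, eval_var, h1, h2, denom, e,
            denom])
    set φ := (forN CtrB (forN CtrC _)).run υ with hφ
    have hφf : ∀ y, y ≠ CtrB → y ≠ CtrC → y ≠ Acc → φ y = τ y := fun y h1 h2 h3 => by
      rw [hφ, run_of_notMem _ (by simp [writes, put, h1, h2, h3]) υ, hυf y h3]
    have hυA : υ Acc 0 = numer σ n k s := by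
      rw [hυ, Store.write_same, if_pos rfl, eval_get, hf 0 (by decide)]
      simp only [eval_add', eval_mul', eval_const, eval_var, eval_size, hf 0 (by decide), hn,
        hf Root (by decide), hk', hcs, numer]
    rw [hυA] at hprod
    simp only [eval_add', eval_mul', eval_var, eval_size,
      hφf 0 (by decide) (by decide) (by decide),
      hφf Root (by decide) (by decide) (by decide), hφf CtrA (by decide) (by decide) (by decide),
      hf 0 (by decide), hn, hf Root (by decide), hk', hcs, Store.write_same, hprod,
      hφf Util (by decide) (by decide) (by decide)]
    refine ⟨fun j hj => ?_, fun i j hi hj => ?_⟩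
    · by_cases hjs : j = s
      · subst hjs
        rw [if_pos rfl, ← prod_ite_ne_mul (k := k) (by omega) hs (fun q r => denom σ n q r)]
        ring
      · rw [if_neg (by omega), h.1 j (by push_cast at hj; omega)]
    · rw [if_neg fun e => hi (index_injective hj (by omega) e).1, h.2 i j hi hj]
  exact ⟨fun j hj => key.1 j ⟨hj.1, hj.2, hj.2⟩, key.2⟩

/-! ### Inserting an agent -/

/-- Finds the agent whose bundle the root likes best. -/
def chooseBundle : Cmd :=
  put Head (var Root) ;;
    .forN CtrA (.ite (slackE (var Root) (var Head) - slackE (var Root) (var CtrA))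
      (put Head (var CtrA)) .skip)

/-- `Cur` always holds the house that the root had at the start; each swap hands it on to the
parent. The walk stops where the parent is the root, since that agent is to receive just this house.
The square in the guard tests for inequality. -/
def exchangeStep : Cmd :=
  .ite ((.get Par (var Cur) - var Root) * (.get Par (var Cur) - var Root))
    (put Tmp (.get Alloc (var Cur)) ;;
      .assign Alloc (var Cur) (.get Alloc (.get Par (var Cur))) ;;
      .assign Alloc (.get Par (var Cur)) (var Tmp) ;; put Cur (.get Par (var Cur))) .skip

/-- Exchanges houses along the cycle consisting of the edge from the root to its favourite bundle
and the path of the tree back to the root. -/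
def exchange : Cmd :=
  .assign Par (var Root) (var Head) ;; put Cur (var Root) ;; .forN CtrA exchangeStep

/-- Takes the utilities of the agent given by the root into account. -/
def insertAgent : Cmd := loadRow ;; growTree ;; chooseBundle ;; exchange

/-- Least slack of the root means greatest utility plus price. The least slack may be negative, as
the root need not be content with her present bundle. -/
theorem chooseBundle_spec {σ : Store} {n : ℕ} (hn : σ 0 1 = n)
    (hk : 0 ≤ σ Root 0 ∧ σ Root 0 < n) :
    (0 ≤ chooseBundle.run σ Head 0 ∧ chooseBundle.run σ Head 0 < n) ∧
      ∀ j : ℤ, 0 ≤ j ∧ j < n →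
        slack (weight σ n) (price σ) (σ Root 0) (chooseBundle.run σ Head 0) ≤
          slack (weight σ n) (price σ) (σ Root 0) j := by
  rw [chooseBundle, run_seq, run_put, eval_var]
  set υ := σ.write Head 0 (σ Root 0) with hυ
  have hυf : ∀ y, y ≠ Head → υ y = σ y := fun y hy => Store.write_ne _ _ _ hy
  have := forN_induction (i := CtrA)
    (p := .ite (slackE (var Root) (var Head) - slackE (var Root) (var CtrA))
      (put Head (var CtrA)) .skip) (σ := υ) (n := n) (by rw [hυf 0 (by decide), hn])
    (I := fun r τ => (0 ≤ τ Head 0 ∧ τ Head 0 < n) ∧ ∀ j : ℤ, 0 ≤ j ∧ j < r →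
        slack (weight σ n) (price σ) (σ Root 0) (τ Head 0) ≤
          slack (weight σ n) (price σ) (σ Root 0) j) ⟨?_, fun j hj => ?_⟩
      fun r τ hr hc hf h => ?_
  · exact this
  · rwa [Store.write_ne _ _ _ (by decide), hυ, Store.write_same, if_pos rfl]
  · push_cast at hj; omega
  · have e : ∀ y, y ≠ Head → y ≠ CtrA → τ y = σ y := fun y h1 h2 => by
      rw [hf y (by simp [writes, put, h1, h2]), hυf y h1]
    have e1 : weight τ n = weight σ n := by
      unfold weight; rw [e Util (by decide) (by decide), e Alloc (by decide) (by decide)]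
    have e2 : price τ = price σ := by
      unfold price; rw [e Price (by decide) (by decide), e Alloc (by decide) (by decide)]
    rw [Store.write_ne _ _ _ (by decide), run_ite]
    rw [eval_sub', eval_slackE (n := n) (by rw [e 0 (by decide) (by decide), hn]),
      eval_slackE (n := n) (by rw [e 0 (by decide) (by decide), hn]), e1, e2, eval_var, eval_var,
      eval_var, e Root (by decide) (by decide), hc]
    split_ifs with h1
    · rw [run_put, eval_var, Store.write_same, if_pos rfl, hc]
      refine ⟨by omega, fun j hj => ?_⟩
      by_cases hjr : j = r
      · rw [hjr]
      · have := h.2 j (by push_cast at hj; omega); omega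
    · rw [run_skip]
      refine ⟨h.1, fun j hj => ?_⟩
      by_cases hjr : j = r
      · rw [hjr]; omega
      · exact h.2 j (by push_cast at hj; omega)

/-- The allocation `a'` arises from `a` by exchanging houses along the first edges of the path given
by `par` that starts in `k` and ends in `x`. -/
structure IsExchanging (n : ℕ) (k : ℤ) (a par : ℤ → ℤ) (rk : ℤ → ℕ) (r : ℕ) (a' : ℤ → ℤ) (x : ℤ) :
    Prop where
  mem : 0 ≤ x ∧ x < n
  injOn : Set.InjOn a' (Set.Ico 0 n)
  last : a' x = a k
  exchanged : ∀ j : ℤ, 0 ≤ j ∧ j < n → j ≠ x → (j ≠ k ∧ a' j = a j) ∨ a' j = a (par j)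
  first : x = k → ∀ j : ℤ, 0 ≤ j ∧ j < n → a' j = a j
  unchanged : x ≠ k → ∀ j : ℤ, 0 ≤ j ∧ j < n → j ≠ k → rk j < rk x → a' j = a j
  -- Either the walk has reached its last agent, or it has not started, or it has lost a unit of
  -- rank in each step after the first. The bound `n + 1` allows for the first step, which enters
  -- the tree at a rank of at most `n`.
  progress : par x = k ∨ (x = k ∧ r = 0) ∨ (x ≠ k ∧ rk x + r ≤ n + 1)

section exchange

variable {n : ℕ} {k : ℤ} {a par : ℤ → ℤ} {rk : ℤ → ℕ} {r : ℕ} {a' : ℤ → ℤ} {x : ℤ}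

theorem IsExchanging.halt (h : IsExchanging n k a par rk r a' x) (hx : par x = k) :
    IsExchanging n k a par rk (r + 1) a' x :=
  ⟨h.mem, h.injOn, h.last, h.exchanged, h.first, h.unchanged, Or.inl hx⟩

/-- Ranks fall along the walk, so the next agent has not been visited and still owns her original
house; that is the one handed to `x`. -/
theorem IsExchanging.step (h : IsExchanging n k a par rk r a' x) (hx : par x ≠ k)
    (hrk : ∀ j : ℤ, 0 ≤ j ∧ j < n → rk j ≤ n)
    (hpar : ∀ j : ℤ, 0 ≤ j ∧ j < n → 0 ≤ par j ∧ par j < n)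
    (hlt : ∀ j : ℤ, 0 ≤ j ∧ j < n → j ≠ k → rk (par j) < rk j) :
    IsExchanging n k a par rk (r + 1)
      (Function.update (Function.update a' x (a' (par x))) (par x) (a' x)) (par x) := by
  have hne : par x ≠ x := by
    intro e
    by_cases hxk : x = k
    · rw [e] at hx; exact hx hxk
    · have := hlt x h.mem hxk; rw [e] at this; omega
  have hy : a' (par x) = a (par x) := by
    by_cases hxk : x = k
    · exact h.first hxk _ (hpar x h.mem)
    · exact h.unchanged hxk _ (hpar x h.mem) hx (hlt x h.mem hxk)
  have hother : ∀ j, j ≠ x → j ≠ par x →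
      Function.update (Function.update a' x (a' (par x))) (par x) (a' x) j = a' j := by
    intro j h1 h2; simp [h1, h2]
  refine ⟨hpar x h.mem, ?_, ?_, fun j hj hjx => ?_, fun e => absurd e hx, fun _ j hj hjk hjr => ?_,
    Or.inr (Or.inr ⟨hx, ?_⟩)⟩
  · have : Function.update (Function.update a' x (a' (par x))) (par x) (a' x) =
        a' ∘ Equiv.swap x (par x) := by
      funext j
      by_cases h1 : j = par x
      · rw [h1, Function.update_self, Function.comp_apply, Equiv.swap_apply_right]
      · by_cases h2 : j = x
        · rw [h2, Function.update_of_ne hne.symm, Function.update_self, Function.comp_apply,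
            Equiv.swap_apply_left]
        · rw [hother j h2 h1, Function.comp_apply, Equiv.swap_apply_of_ne_of_ne h2 h1]
    rw [this]
    refine h.injOn.comp (Equiv.swap x (par x)).injective.injOn fun j hj => ?_
    rw [Equiv.swap_apply_def]
    split_ifs
    exacts [hpar x h.mem, h.mem, hj]
  · simp [h.last]
  · by_cases hjx' : j = x
    · subst hjx'
      right
      simp [Ne.symm hne, hy]
    · rw [hother j hjx' hjx]
      exact h.exchanged j hj hjx'
  · have h1 : j ≠ par x := by rintro rfl; omega
    have h2 : j ≠ x := by
      rintro rfl
      have := hlt j hj hjk; omega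
    rw [hother j h2 h1]
    by_cases hxk : x = k
    · exact h.first hxk j hj
    · exact h.unchanged hxk j hj hjk (hjr.trans (hlt x h.mem hxk))
  · rcases h.progress with h' | ⟨_, rfl⟩ | ⟨hxk, h'⟩
    · exact absurd h' hx
    · have := hrk (par x) (hpar x h.mem); omega
    · have := hlt x h.mem hxk; omega

/-- After `n` steps an unfinished walk would stand at rank at most one with two further strict
descents ahead, which is impossible. -/
theorem IsExchanging.final (h : IsExchanging n k a par rk n a' x)
    (hpar : ∀ j : ℤ, 0 ≤ j ∧ j < n → 0 ≤ par j ∧ par j < n)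
    (hlt : ∀ j : ℤ, 0 ≤ j ∧ j < n → j ≠ k → rk (par j) < rk j) (j : ℤ) (hj : 0 ≤ j ∧ j < n) :
    (j ≠ k ∧ a' j = a j) ∨ a' j = a (par j) := by
  have hx : par x = k := by
    by_contra hx
    rcases h.progress with h' | ⟨_, h'⟩ | ⟨hxk, h'⟩
    · exact hx h'
    · omega
    · have h1 := hlt x h.mem hxk
      have h2 := hlt _ (hpar x h.mem) hx
      omega
  by_cases hjx : j = x
  · right; rw [hjx, h.last, hx]
  · exact h.exchanged j hj hjx

end exchange

theorem exchange_spec {σ : Store} {n : ℕ} {rk : ℤ → ℕ} (hn : σ 0 1 = n)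
    (ha : Set.InjOn (σ Alloc) (Set.Ico 0 n))
    (hk : 0 ≤ σ Root 0 ∧ σ Root 0 < n) (hh : 0 ≤ σ Head 0 ∧ σ Head 0 < n)
    (hrk : ∀ j : ℤ, 0 ≤ j ∧ j < n → rk j ≤ n)
    (hpar : ∀ j : ℤ, 0 ≤ j ∧ j < n → j ≠ σ Root 0 → 0 ≤ σ Par j ∧ σ Par j < n)
    (hlt : ∀ j : ℤ, 0 ≤ j ∧ j < n → j ≠ σ Root 0 → rk (σ Par j) < rk j) :
    Set.InjOn (exchange.run σ Alloc) (Set.Ico 0 n) ∧ ∀ j : ℤ, 0 ≤ j ∧ j < n →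
      (j ≠ σ Root 0 ∧ exchange.run σ Alloc j = σ Alloc j) ∨
        exchange.run σ Alloc j =
          σ Alloc (if j = σ Root 0 then σ Head 0 else σ Par j) := by
  set k := σ Root 0 with hk0
  set par : ℤ → ℤ := fun j => if j = k then σ Head 0 else σ Par j with hpar0
  have hpar' : ∀ j : ℤ, 0 ≤ j ∧ j < n → 0 ≤ par j ∧ par j < n := by
    intro j hj
    by_cases hjk : j = k
    · simpa [hpar0, hjk] using hh
    · simpa [hpar0, hjk] using hpar j hj hjk
  have hlt' : ∀ j : ℤ, 0 ≤ j ∧ j < n → j ≠ k → rk (par j) < rk j := by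
    intro j hj hjk
    simpa [hpar0, hjk] using hlt j hj hjk
  suffices H : ∃ x, IsExchanging n k (σ Alloc) par rk n (exchange.run σ Alloc) x by
    obtain ⟨x, H⟩ := H
    exact ⟨H.injOn, fun j hj => H.final hpar' hlt' j hj⟩
  refine ⟨exchange.run σ Cur 0, ?_⟩
  rw [exchange, run_seq, run_seq, run_assign, run_put, eval_var, eval_var, eval_var,
    Store.write_ne (y := Root) _ _ _ (by decide), ← hk0]
  set υ := (σ.write Par k (σ Head 0)).write Cur 0 k with hυ
  have hυf : ∀ y, y ≠ Par → y ≠ Cur → υ y = σ y := fun y h1 h2 => by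
    rw [hυ, Store.write_ne _ _ _ h2, Store.write_ne _ _ _ h1]
  have hυp : υ Par = par := by
    funext j
    rw [hυ, Store.write_ne _ _ _ (by decide), Store.write_same]
  refine forN_induction (n := n) (by rw [hυf 0 (by decide) (by decide), hn])
    (I := fun r τ => IsExchanging n k (σ Alloc) par rk r (τ Alloc) (τ Cur 0)) ?_
      fun r τ hr hc hf h => ?_
  · rw [Store.write_ne _ _ _ (by decide), Store.write_ne _ _ _ (by decide),
      hυf Alloc (by decide) (by decide), hυ, Store.write_same, if_pos rfl]
    exact ⟨hk, ha, rfl, fun j _ hj => Or.inl ⟨hj, rfl⟩, fun _ _ _ => rfl, fun e => absurd rfl e,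
      Or.inr (Or.inl ⟨rfl, rfl⟩)⟩
  · have e1 : τ Par = par := by rw [hf Par (by decide), hυp]
    have e2 : τ Root 0 = k := by rw [hf Root (by decide), hυf Root (by decide) (by decide)]
    rw [Store.write_ne _ _ _ (by decide), Store.write_ne _ _ _ (by decide)]
    have hcond : (0 < eval τ ((.get Par (var Cur) - var Root) * (.get Par (var Cur) - var Root))) ↔
        par (τ Cur 0) ≠ k := by
      simp only [eval_mul', eval_sub', eval_get, eval_var, e1, e2]
      rw [mul_self_pos, sub_ne_zero]
    rw [exchangeStep, run_ite, if_congr hcond rfl rfl]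
    split_ifs with h1
    · simp only [run_seq, run_put, run_assign, eval_var, eval_get]
      simp only [Store.write_ne, ne_eq, Nat.reduceEqDiff, not_false_eq_true, e1]
      simp only [Store.write_same, if_true]
      convert h.step h1 hrk hpar' hlt' using 1
      funext j
      simp only [Store.write_same, Function.update_apply, Store.write_ne, ne_eq, Nat.reduceEqDiff,
        not_false_eq_true]
    · exact h.halt (not_not.1 h1)

/-- The allocation stored in `τ` is a bijection, and envy-free for the stored prices. -/
structure HoldsEnvyFree (n : ℕ) (τ : Store) : Prop where
  injOn : Set.InjOn (τ Alloc) (Set.Ico 0 n)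
  mapsTo : ∀ j : ℤ, 0 ≤ j ∧ j < n → 0 ≤ τ Alloc j ∧ τ Alloc j < n
  feasible : IsFeasible n (weight τ n) (price τ) fun _ => True

/-- Prices belong to houses and do not change in the exchange, so it suffices that each agent ends
with a favourite house at the prices of the tree: the root by choice, agents on the path by
indifference along tight edges, all others by feasibility. -/
theorem insertAgent_spec {σ : Store} {n : ℕ} (hn : σ 0 1 = n)
    (hk : 0 ≤ σ Root 0 ∧ σ Root 0 < n) (h : HoldsEnvyFree n σ) :
    HoldsEnvyFree n (insertAgent.run σ) := by
  have hrow := loadRow_spec hn hk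
  simp only [insertAgent, run_seq]
  set σ₁ := loadRow.run σ with hσ₁
  have f₁ : ∀ y, y ∉ loadRow.writes → σ₁ y = σ y := fun y hy => run_of_notMem _ hy σ
  have ha₁ : σ₁ Alloc = σ Alloc := f₁ _ (by decide)
  have hn₁ : σ₁ 0 1 = n := by rw [f₁ 0 (by decide), hn]
  have hk₁ : σ₁ Root 0 = σ Root 0 := by rw [f₁ Root (by decide)]
  set k := σ Root 0 with hk0
  -- Only the row of the root was overwritten, so only the root may now be envious.
  have hfeas₁ : IsFeasible n (weight σ₁ n) (price σ₁) (fun j => j ≠ k) := by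
    intro j hj hjk i hi
    have := h.feasible j hj trivial i hi
    simp only [slack, weight, price] at this ⊢
    rwa [ha₁, f₁ Price (by decide), hrow.2 j _ hjk (h.mapsTo j hj), hrow.2 j _ hjk (h.mapsTo i hi)]
  obtain ⟨hfeas₂, rk, hrk, htree⟩ := growTree_spec hn₁ (by rw [ha₁]; exact h.injOn)
    (by rwa [hk₁]) (by rw [hk₁]; exact fun j hj => hj) rfl hfeas₁
  rw [hk₁] at htree
  set σ₂ := growTree.run σ₁ with hσ₂
  have f₂ : ∀ y, y ∉ growTree.writes → σ₂ y = σ₁ y := fun y hy => run_of_notMem _ hy σ₁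
  have hn₂ : σ₂ 0 1 = n := by rw [f₂ 0 (by decide), hn₁]
  have hk₂ : σ₂ Root 0 = k := by rw [f₂ Root (by decide), hk₁]
  have ha₂ : σ₂ Alloc = σ Alloc := by rw [f₂ _ (by decide), ha₁]
  have hw₂ : weight σ₂ n = weight σ₁ n := by
    unfold weight; rw [ha₂, ha₁, f₂ Util (by decide)]
  obtain ⟨hhead, hbest⟩ := chooseBundle_spec hn₂ (by rwa [hk₂])
  rw [hk₂, hw₂] at hbest
  set σ₃ := chooseBundle.run σ₂ with hσ₃
  have f₃ : ∀ y, y ∉ chooseBundle.writes → σ₃ y = σ₂ y := fun y hy => run_of_notMem _ hy σ₂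
  have ha₃ : σ₃ Alloc = σ Alloc := by rw [f₃ _ (by decide), ha₂]
  have hk₃ : σ₃ Root 0 = k := by rw [f₃ Root (by decide), hk₂]
  have hp₃ : σ₃ Par = σ₂ Par := f₃ _ (by decide)
  obtain ⟨hinj, hex⟩ := exchange_spec (σ := σ₃) (n := n) (rk := rk)
    (by rw [f₃ 0 (by decide), hn₂]) (by rw [ha₃]; exact h.injOn) (by rwa [hk₃]) hhead hrk
    (by rw [hk₃, hp₃]; exact fun j hj hjk => (htree j hj hjk).1)
    (by rw [hk₃, hp₃]; exact fun j hj hjk => (htree j hj hjk).2.1)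
  rw [hk₃, hp₃, ha₃] at hex
  set σ₄ := exchange.run σ₃ with hσ₄
  have f₄ : ∀ y, y ∉ exchange.writes → σ₄ y = σ₃ y := fun y hy => run_of_notMem _ hy σ₃
  have hU : σ₄ Util = σ₁ Util := by rw [f₄ _ (by decide), f₃ _ (by decide), f₂ _ (by decide)]
  have hP : σ₄ Price = σ₂ Price := by rw [f₄ _ (by decide), f₃ _ (by decide)]
  -- every agent holds a house that she likes best
  have key : ∀ j : ℤ, 0 ≤ j ∧ j < n → ∃ i : ℤ, (0 ≤ i ∧ i < n) ∧ σ₄ Alloc j = σ Alloc i ∧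
      ∀ l : ℤ, 0 ≤ l ∧ l < n → slack (weight σ₁ n) (price σ₂) j i ≤
        slack (weight σ₁ n) (price σ₂) j l := by
    intro j hj
    rcases hex j hj with ⟨hjk, e⟩ | e
    · refine ⟨j, hj, e, fun l hl => le_trans (le_of_eq ?_) (hfeas₂ j hj hjk l hl)⟩
      simp [slack]
    · by_cases hjk : j = k
      · rw [if_pos hjk] at e
        exact ⟨_, hhead, e, by rw [hjk]; exact hbest⟩
      · rw [if_neg hjk] at e
        obtain ⟨h1, _, h3⟩ := htree j hj hjk
        exact ⟨_, h1, e, fun l hl => h3.le.trans (hfeas₂ j hj hjk l hl)⟩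
  refine ⟨hinj, fun j hj => ?_, fun j hj _ i hi => ?_⟩
  · obtain ⟨i, hi, e, _⟩ := key j hj
    rw [e]; exact h.mapsTo i hi
  · obtain ⟨j', hj', e, hbest'⟩ := key j hj
    obtain ⟨i', hi', e', _⟩ := key i hi
    have := hbest' i' hi'
    simp only [slack, weight, price] at this ⊢
    rw [hU, hP, e, e']
    rw [ha₁, ha₂] at this
    linarith

/-! ### Minimum subsidies and output -/

/-- Raises the subsidies to the lengths of the longest paths to the root. -/
def raiseSubsidies : Cmd :=
  .forN CtrA (.ite (.get Price (.get Alloc (var CtrA)) - .get Price (.get Alloc (var Root)) -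
      .get Subs (var CtrA))
    (.assign Subs (var CtrA)
      (.get Price (.get Alloc (var CtrA)) - .get Price (.get Alloc (var Root)))) .skip)

/-- Each round starts from the prices left by the previous one; these stay envy-free, and only price
differences to the current root matter. -/
def computeSubsidies : Cmd := .forN Root (growTree ;; raiseSubsidies)

def writeOutput : Cmd :=
  .assign 1 (.const 0) (size + size + size) ;;
    .forN CtrA (.assign 1 (.const 1 + var CtrA) (.get Alloc (var CtrA)) ;;
      .assign 1 (.const 1 + size + var CtrA) (.get Subs (var CtrA)) ;;
      .assign 1 (.const 1 + size + size + var CtrA) (var Denom))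

def assignHouses : Cmd := .forN CtrA (.assign Alloc (var CtrA) (var CtrA))

/-- Computes a minimum-subsidy envy-free outcome. -/
def solve : Cmd :=
  multiplyDenoms ;; assignHouses ;; .forN Root insertAgent ;; computeSubsidies ;; writeOutput

theorem raiseSubsidies_spec {σ : Store} {n : ℕ} (hn : σ 0 1 = n) (j : ℤ) (hj : 0 ≤ j ∧ j < n) :
    raiseSubsidies.run σ Subs j = max (σ Subs j) (price σ j - price σ (σ Root 0)) := by
  have key : ∀ j : ℤ, 0 ≤ j → raiseSubsidies.run σ Subs j =
      if j < n then max (σ Subs j) (price σ j - price σ (σ Root 0)) else σ Subs j := by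
    refine forN_induction (n := n) hn (I := fun r τ => ∀ j : ℤ, 0 ≤ j → τ Subs j =
      if j < r then max (σ Subs j) (price σ j - price σ (σ Root 0)) else σ Subs j)
      (fun j h0 => ?_) fun r τ hr hc hf h j h0 => ?_
    · rw [Store.write_ne _ _ _ (by decide), if_neg (by push_cast; omega)]
    · have hr' := h r (by omega)
      rw [if_neg (by omega)] at hr'
      rw [Store.write_ne _ _ _ (by decide)]
      by_cases hjr : j = r
      · subst hjr
        rw [if_pos (show (r : ℤ) < (r + 1 : ℕ) by push_cast; omega), run_ite]
        simp only [eval_sub', eval_get, eval_var, hc, hf Price (by decide), hf Alloc (by decide),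
          hf Root (by decide), hr']
        split_ifs with h1
        · simp only [run_assign, eval_sub', eval_get, eval_var, hc, hf Price (by decide),
            hf Alloc (by decide), hf Root (by decide), Store.write_same, if_true]
          rw [max_eq_right (by unfold price; omega)]; rfl
        · rw [run_skip, hr', max_eq_left (by unfold price; omega)]
      · have hlt : j < ((r + 1 : ℕ) : ℤ) ↔ j < (r : ℤ) := by push_cast; omega
        rw [if_congr hlt rfl rfl, ← h j h0, run_ite]
        split_ifs
        · rw [run_assign, Store.write_same, eval_var, hc, if_neg hjr]
        · rfl
  rw [key j hj.1, if_pos hj.2]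

/-- Along tight paths the prices decrease at most as much as any feasible prices. -/
theorem price_sub_le {n : ℕ} {w : ℤ → ℤ → ℤ} {P par : ℤ → ℤ} {k : ℤ} {rk : ℤ → ℕ}
    (htree : ∀ j : ℤ, 0 ≤ j ∧ j < n → j ≠ k →
      (0 ≤ par j ∧ par j < n) ∧ rk (par j) < rk j ∧ slack w P j (par j) = 0)
    {q : ℤ → ℝ} (hq : ∀ i j : ℤ, (0 ≤ i ∧ i < n) → (0 ≤ j ∧ j < n) →
      (w i j : ℝ) + q j ≤ w i i + q i) (j : ℤ) (hj : 0 ≤ j ∧ j < n) :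
    (P j : ℝ) - P k ≤ q j - q k := by
  -- Induction along the tree path to the root: each edge is tight for `P`, while for `q` it is only
  -- an inequality.
  induction hr : rk j using Nat.strong_induction_on generalizing j with
  | _ r ih =>
    by_cases hjk : j = k
    · rw [hjk]; simp
    · obtain ⟨h1, h2, h3⟩ := htree j hj hjk
      have h4 := ih _ (hr ▸ h2) _ h1 rfl
      have h5 := hq j _ hj h1
      have h6 : (w j j : ℝ) + P j - w j (par j) - P (par j) = 0 := by
        rw [slack] at h3; exact_mod_cast h3
      linarith

/-- A pointwise maximum of envy-eliminating potentials eliminates envy, and each potential, being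
zero at its root, lies below every nonnegative competitor by `price_sub_le`. Hence the result is
least in every coordinate, not only in total. -/
theorem computeSubsidies_spec {σ : Store} {n : ℕ} (hn : σ 0 1 = n) (h : HoldsEnvyFree n σ)
    (hs : ∀ j, σ Subs j = 0) :
    (∀ j : ℤ, 0 ≤ j ∧ j < n → 0 ≤ computeSubsidies.run σ Subs j) ∧
    (∀ i j : ℤ, 0 ≤ i ∧ i < n → 0 ≤ j ∧ j < n →
      weight σ n i j + computeSubsidies.run σ Subs j ≤
        weight σ n i i + computeSubsidies.run σ Subs i) ∧
    ∀ q : ℤ → ℝ, (∀ j : ℤ, 0 ≤ j ∧ j < n → 0 ≤ q j) →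
      (∀ i j : ℤ, 0 ≤ i ∧ i < n → 0 ≤ j ∧ j < n →
        (weight σ n i j : ℝ) + q j ≤ weight σ n i i + q i) →
      ∀ j : ℤ, 0 ≤ j ∧ j < n → (computeSubsidies.run σ Subs j : ℝ) ≤ q j := by
  -- `d k j` is the price of `j` minus that of `k` at the end of round `k`. It is kept as a witness
  -- because later rounds change the prices.
  suffices H : ∃ d : ℤ → ℤ → ℤ,
      IsFeasible n (weight σ n) (price (computeSubsidies.run σ)) (fun _ => True) ∧
      (∀ k : ℤ, 0 ≤ k ∧ k < n → d k k = 0 ∧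
        (∀ j : ℤ, 0 ≤ j ∧ j < n → d k j ≤ computeSubsidies.run σ Subs j) ∧
        ∀ i j : ℤ, 0 ≤ i ∧ i < n → 0 ≤ j ∧ j < n →
          weight σ n i j + d k j ≤ weight σ n i i + d k i) ∧
      (∀ j : ℤ, 0 ≤ j ∧ j < n → 0 ≤ computeSubsidies.run σ Subs j ∧
        (computeSubsidies.run σ Subs j = 0 ∨
          ∃ k : ℤ, (0 ≤ k ∧ k < n) ∧ computeSubsidies.run σ Subs j = d k j)) ∧
      ∀ q : ℤ → ℝ, (∀ j : ℤ, 0 ≤ j ∧ j < n → 0 ≤ q j) →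
        (∀ i j : ℤ, 0 ≤ i ∧ i < n → 0 ≤ j ∧ j < n →
          (weight σ n i j : ℝ) + q j ≤ weight σ n i i + q i) →
        ∀ j : ℤ, 0 ≤ j ∧ j < n → (computeSubsidies.run σ Subs j : ℝ) ≤ q j by
    obtain ⟨d, -, h1, h2, h3⟩ := H
    refine ⟨fun j hj => (h2 j hj).1, fun i j hi hj => ?_, h3⟩
    -- The envy of `i` towards `j` is bounded with the potential attaining the maximum at `j`; if
    -- the subsidy of `j` is zero, `d j` attains it because `d j j = 0`.
    rcases (h2 j hj).2 with e | ⟨k, hk, e⟩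
    · have e1 := (h1 j hj).2.2 i j hi hj
      have e2 := (h1 j hj).2.1 i hi
      rw [(h1 j hj).1] at e1
      omega
    · have e1 := (h1 k hk).2.2 i j hi hj
      have e2 := (h1 k hk).2.1 i hi
      omega
  refine forN_induction (n := n) hn (I := fun r τ => ∃ d : ℤ → ℤ → ℤ,
      IsFeasible n (weight σ n) (price τ) (fun _ => True) ∧
      (∀ k : ℤ, 0 ≤ k ∧ k < r → d k k = 0 ∧ (∀ j : ℤ, 0 ≤ j ∧ j < n → d k j ≤ τ Subs j) ∧
        ∀ i j : ℤ, 0 ≤ i ∧ i < n → 0 ≤ j ∧ j < n →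
          weight σ n i j + d k j ≤ weight σ n i i + d k i) ∧
      (∀ j : ℤ, 0 ≤ j ∧ j < n → 0 ≤ τ Subs j ∧
        (τ Subs j = 0 ∨ ∃ k : ℤ, (0 ≤ k ∧ k < r) ∧ τ Subs j = d k j)) ∧
      ∀ q : ℤ → ℝ, (∀ j : ℤ, 0 ≤ j ∧ j < n → 0 ≤ q j) →
        (∀ i j : ℤ, 0 ≤ i ∧ i < n → 0 ≤ j ∧ j < n →
          (weight σ n i j : ℝ) + q j ≤ weight σ n i i + q i) →
        ∀ j : ℤ, 0 ≤ j ∧ j < n → (τ Subs j : ℝ) ≤ q j) ?_ fun r τ hr hc hf hI => ?_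
  · refine ⟨fun _ _ => 0, h.feasible, fun k hk => by push_cast at hk; omega, fun j _ => ?_,
      fun q hq _ j hj => ?_⟩
    · rw [Store.write_ne _ _ _ (by decide), hs]; simp
    · rw [Store.write_ne _ _ _ (by decide), hs]; simpa using hq j hj
  · obtain ⟨d, hfeas, hd, hsub, hmin⟩ := hI
    have ea : τ Alloc = σ Alloc := hf _ (by decide)
    have ew : weight τ n = weight σ n := by unfold weight; rw [ea, hf Util (by decide)]
    have hn' : τ 0 1 = n := by rw [hf 0 (by decide), hn]
    obtain ⟨hfeas', rk, -, htree⟩ := growTree_spec hn' (by rw [ea]; exact h.injOn)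
      (by rw [hc]; omega) (fun _ _ => trivial) ew hfeas
    rw [hc] at htree
    rw [run_seq]
    set υ := growTree.run τ with hυ
    have fυ : ∀ y, y ∉ growTree.writes → υ y = τ y := fun y hy => run_of_notMem _ hy τ
    have hraise := raiseSubsidies_spec (σ := υ) (n := n) (by rw [fυ 0 (by decide), hn'])
    rw [fυ Root (by decide), hc, fυ Subs (by decide)] at hraise
    set φ := raiseSubsidies.run υ with hφ
    have eφ : price (φ.write Root 0 ((r : ℤ) + 1)) = price υ := by
      unfold price
      rw [Store.write_ne _ _ _ (by decide), Store.write_ne _ _ _ (by decide),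
        hφ, run_of_notMem _ (by decide), run_of_notMem _ (by decide)]
    rw [eφ, Store.write_ne (y := Subs) _ _ _ (by decide)]
    refine ⟨fun k j => if k = r then price υ j - price υ r else d k j, hfeas', fun k hk => ?_,
      fun j hj => ?_, fun q hq0 hq j hj => ?_⟩
    · by_cases hkr : k = r
      · subst hkr
        simp only [if_true]
        refine ⟨by omega, fun j hj => by rw [hraise j hj]; exact le_max_right _ _,
          fun i j hi hj => ?_⟩
        have := hfeas' i hi trivial j hj
        rw [slack] at this
        omega
      · simp only [if_neg hkr]
        obtain ⟨h1, h2, h3⟩ := hd k (by push_cast at hk; omega)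
        exact ⟨h1, fun j hj => by rw [hraise j hj]; exact (h2 j hj).trans (le_max_left _ _), h3⟩
    · rw [hraise j hj]
      refine ⟨(hsub j hj).1.trans (le_max_left _ _), ?_⟩
      rcases max_choice (τ Subs j) (price υ j - price υ r) with e | e <;> rw [e]
      · rcases (hsub j hj).2 with e1 | ⟨k, hk, e1⟩
        · exact Or.inl e1
        · refine Or.inr ⟨k, by push_cast; omega, ?_⟩
          simp only [if_neg (show k ≠ (r : ℤ) by omega), e1]
      · exact Or.inr ⟨r, by push_cast; omega, by simp⟩
    · rw [hraise j hj]
      push_cast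
      refine max_le (hmin q hq0 hq j hj) ?_
      have := price_sub_le htree hq j hj
      have := hq0 r (by omega)
      linarith

/-! ### Output and correctness of the whole algorithm over the integers. -/

theorem writeOutput_spec {σ : Store} {n : ℕ} (hn : σ 0 1 = n) :
    writeOutput.run σ 1 0 = n + n + n ∧ ∀ j : ℤ, 0 ≤ j ∧ j < n →
      writeOutput.run σ 1 (1 + j) = σ Alloc j ∧ writeOutput.run σ 1 (1 + n + j) = σ Subs j ∧
        writeOutput.run σ 1 (1 + n + n + j) = σ Denom 0 := by
  rw [writeOutput, run_seq, run_assign]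
  set υ := σ.write 1 (eval σ (.const 0)) (eval σ (size + size + size)) with hυ
  have fυ : ∀ y, y ≠ 1 → υ y = σ y := fun y hy => Store.write_ne _ _ _ hy
  have hυ0 : υ 1 0 = n + n + n := by
    rw [hυ, Store.write_same, eval_const, if_pos rfl]
    simp only [eval_add', eval_size, hn]
  have := forN_induction (i := CtrA) (σ := υ)
    (p := .assign 1 (.const 1 + var CtrA) (.get Alloc (var CtrA)) ;;
      .assign 1 (.const 1 + size + var CtrA) (.get Subs (var CtrA)) ;;
      .assign 1 (.const 1 + size + size + var CtrA) (var Denom)) (n := n)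
    (by rw [fυ 0 (by decide), hn])
    (I := fun r τ => τ 1 0 = n + n + n ∧ ∀ j : ℤ, 0 ≤ j ∧ j < r →
      τ 1 (1 + j) = σ Alloc j ∧ τ 1 (1 + n + j) = σ Subs j ∧
        τ 1 (1 + n + n + j) = σ Denom 0) ⟨?_, fun j hj => ?_⟩ fun r τ hr hc hf h => ?_
  · exact this
  · rw [Store.write_ne _ _ _ (by decide), hυ0]
  · push_cast at hj; omega
  · have e : ∀ y, y ≠ 1 → y ≠ CtrA → τ y = σ y := fun y h1 h2 => by
      rw [hf y (by simp [writes, h1, h2]), fυ y h1]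
    rw [Store.write_ne _ _ _ (by decide)]
    simp only [run_seq, run_assign, eval_add', eval_const, eval_size, eval_var, eval_get]
    simp only [Store.write_ne, ne_eq, not_false_eq_true, OfNat.ofNat_ne_one, zero_ne_one, hc, e 0 (by decide) (by decide), hn,
      e Alloc (by decide) (by decide), e Subs (by decide) (by decide),
      e Denom (by decide) (by decide)]
    simp only [Store.write_same]
    refine ⟨?_, fun j hj => ?_⟩
    · rw [if_neg (by omega), if_neg (by omega), if_neg (by omega), h.1]
    · by_cases hjr : j = r
      · subst hjr
        refine ⟨?_, ?_, if_pos rfl⟩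
        · rw [if_neg (by omega), if_neg (by omega), if_pos rfl]
        · rw [if_neg (by omega), if_pos rfl]
      · obtain ⟨h1, h2, h3⟩ := h.2 j (by push_cast at hj; omega)
        push_cast at hj
        refine ⟨?_, ?_, ?_⟩
        · rw [if_neg (by omega), if_neg (by omega), if_neg (by omega), h1]
        · rw [if_neg (by omega), if_neg (by omega), if_neg (by omega), h2]
        · rw [if_neg (by omega), if_neg (by omega), if_neg (by omega), h3]

theorem solve_spec {σ : Store} {n : ℕ} (hn : σ 0 1 = n) (h0 : ∀ x, x ≠ 0 → ∀ k, σ x k = 0) :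
    ∃ (a s : ℤ → ℤ) (v : ℤ → ℤ → ℤ), Set.InjOn a (Set.Ico 0 n) ∧
      (∀ j : ℤ, 0 ≤ j ∧ j < n → 0 ≤ a j ∧ a j < n) ∧
      (∀ i j : ℤ, 0 ≤ i ∧ i < n → 0 ≤ j ∧ j < n → v i j * denom σ n i j =
        numer σ n i j * ∏ q ∈ Finset.range n, ∏ r ∈ Finset.range n, denom σ n q r) ∧
      (∀ j : ℤ, 0 ≤ j ∧ j < n → 0 ≤ s j) ∧
      (∀ i j : ℤ, 0 ≤ i ∧ i < n → 0 ≤ j ∧ j < n → v i (a j) + s j ≤ v i (a i) + s i) ∧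
      (∀ q : ℤ → ℝ, (∀ j : ℤ, 0 ≤ j ∧ j < n → 0 ≤ q j) →
        (∀ i j : ℤ, 0 ≤ i ∧ i < n → 0 ≤ j ∧ j < n → (v i (a j) : ℝ) + q j ≤ v i (a i) + q i) →
        ∀ j : ℤ, 0 ≤ j ∧ j < n → (s j : ℝ) ≤ q j) ∧
      solve.run σ 1 0 = n + n + n ∧ ∀ j : ℤ, 0 ≤ j ∧ j < n →
        solve.run σ 1 (1 + j) = a j ∧ solve.run σ 1 (1 + n + j) = s j ∧
          solve.run σ 1 (1 + n + n + j) =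
            ∏ q ∈ Finset.range n, ∏ r ∈ Finset.range n, denom σ n q r := by
  simp only [solve, run_seq]
  have hD := multiplyDenoms_spec hn
  set D := ∏ q ∈ Finset.range n, ∏ r ∈ Finset.range n, denom σ n q r
  set σ₁ := multiplyDenoms.run σ with hσ₁
  have f₁ : ∀ y, y ∉ multiplyDenoms.writes → σ₁ y = σ y := fun y hy => run_of_notMem _ hy σ
  have hn₁ : σ₁ 0 1 = n := by rw [f₁ 0 (by decide), hn]
  have hinit : ∀ j : ℤ, 0 ≤ j ∧ j < n → assignHouses.run σ₁ Alloc j = j := by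
    refine forN_induction (n := n) hn₁ (I := fun r τ => ∀ j : ℤ, 0 ≤ j ∧ j < r → τ Alloc j = j)
      (fun j hj => by push_cast at hj; omega) fun r τ hr hc hf h j hj => ?_
    rw [Store.write_ne _ _ _ (by decide), run_assign, Store.write_same, eval_var, hc]
    split_ifs with hjr
    · exact hjr.symm
    · exact h j (by push_cast at hj; omega)
  set σ₂ := assignHouses.run σ₁ with hσ₂
  have f₂ : ∀ y, y ∉ assignHouses.writes → σ₂ y = σ₁ y := fun y hy => run_of_notMem _ hy σ₁
  have hn₂ : σ₂ 0 1 = n := by rw [f₂ 0 (by decide), hn₁]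
  have z₂ : ∀ y, y ≠ 0 → y ∉ multiplyDenoms.writes → y ∉ assignHouses.writes → ∀ k, σ₂ y k = 0 := by
    intro y hy h1 h2 k
    rw [f₂ y h2, f₁ y h1, h0 y hy]
  have e₂ : σ₂ 0 = σ 0 := by rw [f₂ 0 (by decide), f₁ 0 (by decide)]
  have hmatch : HoldsEnvyFree n ((forN Root insertAgent).run σ₂) ∧
      ∀ i j : ℤ, 0 ≤ i ∧ i < n → 0 ≤ j ∧ j < n →
        (forN Root insertAgent).run σ₂ Util (i * n + j) * denom σ n i j = numer σ n i j * D := by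
    refine forN_induction (n := n) hn₂ (I := fun r τ => HoldsEnvyFree n τ ∧
      ∀ i j : ℤ, 0 ≤ i ∧ i < r → 0 ≤ j ∧ j < n →
        τ Util (i * n + j) * denom σ n i j = numer σ n i j * D) ⟨?_, fun i j hi => ?_⟩
      fun r τ hr hc hf h => ?_
    -- At the start all stored utilities and prices are zero, so the identity allocation is
    -- envy-free.
    · have eA := Store.write_ne σ₂ (x := Root) (y := Alloc) 0 0 (by decide)
      refine ⟨?_, fun j hj => ?_, fun j hj _ i hi => ?_⟩
      · rw [eA]
        intro i hi j hj e
        rwa [hinit i hi, hinit j hj] at e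
      · rw [eA, hinit j hj]; exact hj
      · simp only [slack, weight, price]
        rw [Store.write_ne _ _ _ (by decide), Store.write_ne _ _ _ (by decide),
          Store.write_ne _ _ _ (by decide)]
        simp only [z₂ Util (by decide) (by decide) (by decide),
          z₂ Price (by decide) (by decide) (by decide)]
        simp
    · push_cast at hi; omega
    · have e : τ 0 = σ 0 := by rw [hf 0 (by decide), e₂]
      have hnτ : τ 0 1 = n := by rw [e, hn]
      have hk : 0 ≤ τ Root 0 ∧ τ Root 0 < n := by rw [hc]; omega
      have hins := insertAgent_spec hnτ hk h.1
      have hrow := loadRow_spec hnτ hk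
      have eU : insertAgent.run τ Util = loadRow.run τ Util := by
        simp only [insertAgent, run_seq]
        rw [run_of_notMem exchange (by decide), run_of_notMem chooseBundle (by decide),
          run_of_notMem growTree (by decide)]
      refine ⟨⟨?_, ?_, ?_⟩, fun i j hi hj => ?_⟩
      · rw [Store.write_ne _ _ _ (by decide)]; exact hins.injOn
      · rw [Store.write_ne _ _ _ (by decide)]; exact hins.mapsTo
      · have := hins.feasible
        unfold weight price at this ⊢
        rw [Store.write_ne _ _ _ (by decide), Store.write_ne _ _ _ (by decide),
          Store.write_ne _ _ _ (by decide)]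
        exact this
      · rw [Store.write_ne _ _ _ (by decide), eU]
        by_cases hir : i = r
        · have := hrow.1 j hj
          unfold denom numer at this
          rw [e, hc] at this
          rw [hir]
          exact this
        · rw [hrow.2 i j (by rwa [hc]) hj]
          exact h.2 i j (by push_cast at hi; omega) hj
  set σ₃ := (forN Root insertAgent).run σ₂ with hσ₃
  have f₃ : ∀ y, y ∉ (forN Root insertAgent).writes → σ₃ y = σ₂ y :=
    fun y hy => run_of_notMem _ hy σ₂
  have hn₃ : σ₃ 0 1 = n := by rw [f₃ 0 (by decide), hn₂]
  obtain ⟨s1, s2, s3⟩ := computeSubsidies_spec hn₃ hmatch.1 (fun j => by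
    rw [f₃ Subs (by decide), z₂ Subs (by decide) (by decide) (by decide)])
  set σ₄ := computeSubsidies.run σ₃ with hσ₄
  have f₄ : ∀ y, y ∉ computeSubsidies.writes → σ₄ y = σ₃ y := fun y hy => run_of_notMem _ hy σ₃
  have hout := writeOutput_spec (σ := σ₄) (n := n) (by rw [f₄ 0 (by decide), hn₃])
  rw [f₄ Alloc (by decide), f₄ Denom (by decide), f₃ Denom (by decide), f₂ Denom (by decide),
    hD] at hout
  exact ⟨σ₃ Alloc, σ₄ Subs, fun i j => σ₃ Util (i * n + j), hmatch.1.injOn, hmatch.1.mapsTo,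
    hmatch.2, s1, s2, s3, hout⟩

theorem solve_wf : solve.wf = true := by decide

/-! ## Envy-free outcomes and maximum-weight matchings -/

section transfer

variable {n : ℕ} {u : Fin n → Fin n → ℝ} {a : Fin n ↪ Fin n} {s : Fin n → ℝ}

/-- The subsidies of an envy-free outcome, as prices of the houses. -/
theorem IsEnvyFree.exists_prices (h : IsEnvyFree u a s) : ∃ p : Fin n → ℝ,
    (∀ h, 0 ≤ p h) ∧ (∀ i, p (a i) = s i) ∧ ∀ i h, u i h + p h ≤ u i (a i) + p (a i) := by
  set e := a.equivOfFiniteSelfEmbedding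
  have he : ∀ i, e i = a i := fun i => rfl
  have hp : ∀ i, s (e.symm (a i)) = s i := fun i => by rw [← he, e.symm_apply_apply]
  refine ⟨fun h => s (e.symm h), fun h' => h.1 _, hp, fun i h' => ?_⟩
  have := h.2 i (e.symm h')
  rw [← he, e.apply_symm_apply] at this
  simpa only [hp] using this

theorem sum_comp_allocation (a : Fin n ↪ Fin n) (p : Fin n → ℝ) : ∑ i, p (a i) = ∑ h, p h :=
  a.equivOfFiniteSelfEmbedding.sum_comp p

/-- Any two allocations use all houses, so the total price is the same on both sides of the summed
inequalities and cancels. -/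
theorem IsEnvyFree.isMaxWeight (h : IsEnvyFree u a s) : IsMaxWeight u a := by
  obtain ⟨p, -, -, hp⟩ := h.exists_prices
  intro a'
  have := Finset.sum_le_sum fun i (_ : i ∈ Finset.univ) => hp i (a' i)
  rw [Finset.sum_add_distrib, Finset.sum_add_distrib, sum_comp_allocation, sum_comp_allocation]
    at this
  linarith

/-- The prices of an envy-free outcome support every maximum-weight matching. -/
theorem IsEnvyFree.transfer (h : IsEnvyFree u a s) {a' : Fin n ↪ Fin n} (ha' : IsMaxWeight u a') :
    ∃ s', IsEnvyFree u a' s' ∧ ∑ i, s' i = ∑ i, s i := by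
  obtain ⟨p, hp0, hps, hp⟩ := h.exists_prices
  have hle : ∀ i ∈ Finset.univ, u i (a' i) + p (a' i) ≤ u i (a i) + p (a i) :=
    fun i _ => hp i (a' i)
  -- Termwise inequalities whose sums agree, by maximality of `a'`, are equalities: each agent is
  -- indifferent between her two houses.
  have heq : ∀ i, u i (a' i) + p (a' i) = u i (a i) + p (a i) := by
    have := (Finset.sum_eq_sum_iff_of_le hle).1 (le_antisymm (Finset.sum_le_sum hle) (by
      rw [Finset.sum_add_distrib, Finset.sum_add_distrib, sum_comp_allocation,
        sum_comp_allocation]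
      have := ha' a
      linarith))
    exact fun i => this i (Finset.mem_univ i)
  refine ⟨fun i => p (a' i), ⟨fun i => hp0 _, fun i i' => ?_⟩, ?_⟩
  · rw [heq]; exact hp i _
  · rw [sum_comp_allocation, ← sum_comp_allocation a]
    exact Finset.sum_congr rfl fun i _ => hps i

/-- Every competing outcome can be moved to the allocation `a` without changing its total. -/
theorem IsMinEnvyEliminating.isMinSubsidyEnvyFree (ha : IsMaxWeight u a)
    (h : IsMinEnvyEliminating u a s) : IsMinSubsidyEnvyFree u a s := by
  refine ⟨h.1, fun a' s' h' => ?_⟩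
  obtain ⟨s'', h'', e⟩ := h'.transfer ha
  exact e ▸ h.2 s'' h''

/-- If some subsidies eliminate envy, then so do pointwise minimal ones. -/
theorem IsEnvyFree.exists_isMinEnvyEliminating (h : IsEnvyFree u a s) :
    ∃ s, IsMinEnvyEliminating u a s := by
  let ι := {s : Fin n → ℝ // IsEnvyFree u a s}
  have : Nonempty ι := ⟨⟨s, h⟩⟩
  have hbdd : ∀ i, BddBelow (Set.range fun s : ι => s.1 i) := fun i =>
    ⟨0, by rintro _ ⟨s, rfl⟩; exact s.2.1 i⟩
  refine ⟨fun i => ⨅ s : ι, s.1 i, ⟨fun i => le_ciInf fun s => s.2.1 i, fun i i' => ?_⟩,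
    fun s' hs' => Finset.sum_le_sum fun i _ => ciInf_le (hbdd i) ⟨s', hs'⟩⟩
  have key : u i (a i') + (⨅ s : ι, s.1 i') - u i (a i) ≤ ⨅ s : ι, s.1 i := by
    refine le_ciInf fun s => ?_
    have h1 := ciInf_le (hbdd i') s
    have h2 := s.2.2 i i'
    linarith
  linarith

/-! ### From rational to real utilities. -/

theorem IsEnvyFree.exists_le {C : ℝ} (hC : ∀ i h, 0 ≤ u i h ∧ u i h ≤ C) (h : IsEnvyFree u a s) :
    ∃ s', IsEnvyFree u a s' ∧ ∀ i, s' i ≤ C := by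
  rcases isEmpty_or_nonempty (Fin n) with hn | hn
  · exact ⟨s, h, fun i => isEmptyElim i⟩
  · obtain ⟨i₀, hi₀⟩ := Finite.exists_min s
    -- Subtracting the least subsidy preserves envy-freeness. Agent `i₀` then receives nothing, so
    -- her lack of envy bounds every subsidy by her utility.
    refine ⟨fun i => s i - s i₀, ⟨fun i => sub_nonneg.2 (hi₀ i), fun i i' => ?_⟩, fun i => ?_⟩
    · have := h.2 i i'; linarith
    · have h1 := h.2 i₀ i
      have h2 := (hC i₀ (a i)).1
      have h3 := (hC i₀ (a i₀)).2
      simp only; linarith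

/-- Envy-free outcomes exist for real utilities if they exist for rational utilities. -/
theorem exists_isEnvyFree_of_rat
    (hrat : ∀ I : RatInstance n n, ∃ a s, IsEnvyFree I.utility a s) (hu : ∀ i h, 0 ≤ u i h) :
    ∃ a s, IsEnvyFree u a s := by
  obtain ⟨C, hC⟩ : ∃ C, ∀ i h, u i h ≤ C := by
    obtain ⟨C, hC⟩ := (Set.finite_range fun x : Fin n × Fin n => u x.1 x.2).bddAbove
    exact ⟨C, fun i h => hC ⟨(i, h), rfl⟩⟩
  -- Rounding down to multiples of `1 / (m + 1)` keeps the bound `C`, which makes the subsidies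
  -- range over a fixed compact box.
  let I : ℕ → RatInstance n n := fun m =>
    ⟨fun i h => ⌊u i h * (m + 1 : ℕ)⌋₊, fun _ _ => m + 1, fun _ _ => m.succ_pos⟩
  have hI : ∀ m i h, (I m).utility i h = (⌊u i h * (m + 1 : ℕ)⌋₊ : ℝ) / (m + 1 : ℕ) :=
    fun m i h => rfl
  have hlim : ∀ i h, Filter.Tendsto (fun m => (I m).utility i h) Filter.atTop (nhds (u i h)) := by
    intro i h
    have h1 := (tendsto_nat_floor_mul_div_atTop (R := ℝ) (hu i h)).comp
      (tendsto_natCast_atTop_atTop.comp (Filter.tendsto_add_atTop_nat 1))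
    exact h1
  have hex : ∀ m, ∃ x : (Fin n ↪ Fin n) × (Fin n → ℝ), IsEnvyFree (I m).utility x.1 x.2 ∧
      x.2 ∈ Set.Icc (0 : Fin n → ℝ) (fun _ => C) := by
    intro m
    obtain ⟨a, s, h⟩ := hrat (I m)
    obtain ⟨s', h', hs'⟩ := h.exists_le (C := C) fun i h => by
      rw [hI]
      refine ⟨by positivity, ?_⟩
      rw [div_le_iff₀ (by positivity)]
      exact (Nat.floor_le (mul_nonneg (hu i h) (by positivity))).trans
        (mul_le_mul_of_nonneg_right (hC i h) (by positivity))
    exact ⟨(a, s'), h', fun i => h'.1 i, fun i => hs' i⟩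
  choose x hx hxC using hex
  -- There are finitely many allocations, so one occurs for infinitely many `m`; a further
  -- subsequence makes the subsidies converge.
  obtain ⟨a, ha⟩ := Finite.exists_infinite_fiber fun m => (x m).1
  rw [Set.infinite_coe_iff] at ha
  obtain ⟨φ, hφ, hφa⟩ := Filter.extraction_of_frequently_atTop
    (Nat.frequently_atTop_iff_infinite.2 ha)
  obtain ⟨s, -, ψ, hψ, hs⟩ := (isCompact_Icc (a := (0 : Fin n → ℝ)) (b := fun _ => C)).tendsto_subseq
    fun m => hxC (φ m)
  have hs' := tendsto_pi_nhds.1 hs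
  have hua : ∀ i h, Filter.Tendsto (fun m => (I (φ (ψ m))).utility i h) Filter.atTop
      (nhds (u i h)) := fun i h => (hlim i h).comp (hφ.comp hψ).tendsto_atTop
  refine ⟨a, s, fun i => ge_of_tendsto' (hs' i) fun m => (hx _).1 i, fun i i' => ?_⟩
  refine le_of_tendsto_of_tendsto' ((hua i (a i')).add (hs' i')) ((hua i (a i)).add (hs' i))
    fun m => ?_
  have := (hx (φ (ψ m))).2 i i'
  rwa [show (x (φ (ψ m))).1 = a from hφa (ψ m)] at this

end transfer

/-! ## Encodings -/

theorem getD_encode {n : ℕ} (I : RatInstance n n) (k : ℕ) :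
    (I.encode.length :: I.encode).getD (k + 3) 0 =
      ((List.ofFn fun k : Fin (n * n) => I.num k.divNat k.modNat) ++
        List.ofFn fun k : Fin (n * n) => I.den k.divNat k.modNat).getD k 0 := rfl

theorem getD_ofFn {N : ℕ} (f : Fin N → ℕ) {k : ℕ} (hk : k < N) :
    (List.ofFn f).getD k 0 = f ⟨k, hk⟩ := by
  rw [List.getD_eq_getElem _ _ (by simpa using hk), List.getElem_ofFn]

theorem mul_add_lt {n i j : ℕ} (hi : i < n) (hj : j < n) : i * n + j < n * n :=
  calc i * n + j < (i + 1) * n := by rw [add_mul]; omega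
    _ ≤ n * n := Nat.mul_le_mul_right n hi

theorem inputStore_natCast (l : List ℕ) (k : ℕ) :
    inputStore l 0 (k : ℤ) = ((l.length :: l).getD k 0 : ℕ) := by
  simp [inputStore]

section encode

variable {n : ℕ} (I : RatInstance n n)

theorem inputStore_encode_one : inputStore I.encode 0 1 = n :=
  inputStore_natCast I.encode 1

theorem numer_inputStore (i j : Fin n) :
    numer (inputStore I.encode) n (i : ℕ) (j : ℕ) = I.num i j := by
  have hlt := mul_add_lt i.2 j.2
  have hn : 0 < n := i.pos
  rw [numer, show (3 : ℤ) + (i : ℕ) * n + (j : ℕ) = ((i * n + j + 3 : ℕ) : ℤ) by push_cast; ring,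
    inputStore_natCast, getD_encode, List.getD_append _ _ _ _ (by simpa using hlt),
    getD_ofFn _ hlt]
  congr 2
  · ext; simp [Fin.divNat, mul_comm, Nat.mul_add_div hn, Nat.div_eq_of_lt j.2]
  · ext; simp [Fin.modNat, Nat.mod_eq_of_lt j.2]

theorem denom_inputStore (i j : Fin n) :
    denom (inputStore I.encode) n (i : ℕ) (j : ℕ) = I.den i j := by
  have hlt := mul_add_lt i.2 j.2
  have hn : 0 < n := i.pos
  rw [denom, show (3 : ℤ) + n * n + (i : ℕ) * n + (j : ℕ) = ((n * n + (i * n + j) + 3 : ℕ) : ℤ) by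
      push_cast; ring,
    inputStore_natCast, getD_encode, List.getD_append_right _ _ _ _ (by simp)]
  simp only [List.length_ofFn, Nat.add_sub_cancel_left]
  rw [getD_ofFn _ hlt]
  congr 2
  · ext; simp [Fin.divNat, mul_comm, Nat.mul_add_div hn, Nat.div_eq_of_lt j.2]
  · ext; simp [Fin.modNat, Nat.mod_eq_of_lt j.2]

end encode

theorem holdsOutput_encodeOutcome {n : ℕ} {σ : Store} {a : Fin n ↪ Fin n} {num den : Fin n → ℕ}
    (h0 : σ 1 0 = n + n + n) (ha : ∀ i : Fin n, σ 1 (1 + (i : ℕ)) = (a i : ℕ))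
    (hnum : ∀ i : Fin n, σ 1 (1 + n + (i : ℕ)) = num i)
    (hden : ∀ i : Fin n, σ 1 (1 + n + n + (i : ℕ)) = den i) :
    HoldsOutput σ (encodeOutcome a num den) := by
  have hlen : (encodeOutcome a num den).length = n + n + n := by
    simp [encodeOutcome, add_assoc]
  intro k hk
  rw [hlen] at hk
  rcases k with _ | k
  · simp [h0, hlen]
  · rw [List.getD_cons_succ, encodeOutcome]
    rcases lt_or_ge k n with h1 | h1
    · have := ha ⟨k, h1⟩
      rw [List.getD_append _ _ _ _ (by simp; omega), List.getD_append _ _ _ _ (by simpa using h1),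
        getD_ofFn _ h1, ← this]
      congr 1; push_cast; ring
    · rcases lt_or_ge (k - n) n with h2 | h2
      · have := hnum ⟨k - n, h2⟩
        rw [List.getD_append _ _ _ _ (by simp; omega),
          List.getD_append_right _ _ _ _ (by simpa using h1), List.length_ofFn, getD_ofFn _ h2,
          ← this]
        congr 1; push_cast [h1]; ring
      · have h3 : k - (n + n) < n := by omega
        have := hden ⟨k - (n + n), h3⟩
        rw [List.getD_append_right _ _ _ _ (by simp; omega), List.length_append, List.length_ofFn,
          List.length_ofFn, getD_ofFn _ h3, ← this]
        congr 1; push_cast [show n + n ≤ k by omega]; ring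

/-! ## Correctness and running time -/

/-- Dividing by the common denominator carries the integral result back. Besides correctness of the
algorithm, this supplies the existence of envy-free outcomes for rational utilities. -/
theorem exists_isSolution {n : ℕ} (I : RatInstance n n) :
    ∃ out, HoldsOutput (solve.run (inputStore I.encode)) out ∧ IsSolution I out := by
  obtain ⟨a, s, v, hinj, hmaps, hv, hs0, hfeas, hmin, hout0, hout⟩ :=
    solve_spec (inputStore_encode_one I) (fun x hx k => by simp [inputStore, hx])
  set σ := inputStore I.encode
  have hfin : ∀ i : Fin n, (0 : ℤ) ≤ (i : ℕ) ∧ ((i : ℕ) : ℤ) < n := fun i => by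
    have := i.2; omega
  set Dn : ℕ := ∏ q : Fin n, ∏ r : Fin n, I.den q r with hDn
  have hD : ∏ q ∈ Finset.range n, ∏ r ∈ Finset.range n, denom σ n q r = Dn := by
    rw [hDn, Finset.prod_range]
    push_cast
    refine Finset.prod_congr rfl fun q _ => ?_
    rw [Finset.prod_range]
    exact Finset.prod_congr rfl fun r _ => denom_inputStore I q r
  have hDpos : 0 < Dn := Finset.prod_pos fun q _ => Finset.prod_pos fun r _ => I.den_pos q r
  have hDpos' : (0 : ℝ) < Dn := by exact_mod_cast hDpos
  rw [hD] at hv hout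
  let A : Fin n ↪ Fin n := ⟨fun i => ⟨(a (i : ℕ)).toNat, by
      have := hmaps _ (hfin i); omega⟩, fun i j hij => by
    have h1 := hmaps _ (hfin i)
    have h2 := hmaps _ (hfin j)
    have h3 : (a (i : ℕ)).toNat = (a (j : ℕ)).toNat := congrArg Fin.val hij
    have h4 := hinj (hfin i) (hfin j) (by omega)
    exact Fin.ext (by exact_mod_cast h4)⟩
  have hA : ∀ i : Fin n, ((A i : ℕ) : ℤ) = a (i : ℕ) := fun i =>
    Int.toNat_of_nonneg (hmaps _ (hfin i)).1
  let S : Fin n → ℕ := fun i => (s (i : ℕ)).toNat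
  have hS : ∀ i : Fin n, (S i : ℤ) = s (i : ℕ) := fun i => Int.toNat_of_nonneg (hs0 _ (hfin i))
  have hutil : ∀ i h : Fin n, ((v (i : ℕ) (h : ℕ) : ℤ) : ℝ) = I.utility i h * Dn := by
    intro i h
    have h1 := hv _ _ (hfin i) (hfin h)
    rw [denom_inputStore, numer_inputStore] at h1
    have h2 : ((v (i : ℕ) (h : ℕ) : ℤ) : ℝ) * I.den i h = I.num i h * Dn := by exact_mod_cast h1
    have h3 : (0 : ℝ) < I.den i h := by exact_mod_cast I.den_pos i h
    rw [RatInstance.utility]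
    field_simp
    linarith
  refine ⟨encodeOutcome A S fun _ => Dn, holdsOutput_encodeOutcome hout0
    (fun i => ?_) (fun i => ?_) (fun i => ?_), A, S, fun _ => Dn, rfl, fun _ => hDpos, ?_⟩
  · rw [(hout _ (hfin i)).1, hA]
  · rw [(hout _ (hfin i)).2.1, hS]
  · exact (hout _ (hfin i)).2.2
  · have hEF : IsEnvyFree I.utility A fun i => (S i : ℝ) / (Dn : ℝ) := by
      refine ⟨fun i => by positivity, fun i i' => ?_⟩
      have h1 := hfeas _ _ (hfin i) (hfin i')
      rw [← hA, ← hA, ← hS, ← hS] at h1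
      have h2 : ((v (i : ℕ) (A i' : ℕ) : ℤ) : ℝ) + S i' ≤ (v (i : ℕ) (A i : ℕ) : ℤ) + S i := by
        exact_mod_cast h1
      rw [hutil, hutil] at h2
      rw [← mul_le_mul_iff_left₀ hDpos', add_mul, add_mul, div_mul_cancel₀ _ hDpos'.ne',
        div_mul_cancel₀ _ hDpos'.ne']
      exact h2
    refine IsMinEnvyEliminating.isMinSubsidyEnvyFree hEF.isMaxWeight
      ⟨hEF, fun s' hs' => Finset.sum_le_sum fun i _ => ?_⟩
    -- A competing subsidy vector, scaled by the common denominator and extended by zero, becomes a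
    -- competitor for the integral utilities.
    set q : ℤ → ℝ := fun j => if h : j.toNat < n then s' ⟨j.toNat, h⟩ * Dn else 0 with hq
    have hqF : ∀ i : Fin n, q (i : ℕ) = s' i * Dn := fun i => by simp [hq]
    have hlift : ∀ j : ℤ, 0 ≤ j ∧ j < n → ∃ i : Fin n, j = (i : ℕ) := fun j hj =>
      ⟨⟨j.toNat, by omega⟩, (Int.toNat_of_nonneg hj.1).symm⟩
    have := hmin q (fun j hj => ?_) (fun j k hj hk => ?_) _ (hfin i)
    · rw [hqF, ← hS] at this
      rw [div_le_iff₀ hDpos']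
      exact_mod_cast this
    · obtain ⟨i, rfl⟩ := hlift j hj
      rw [hqF]
      exact mul_nonneg (hs'.1 i) hDpos'.le
    · obtain ⟨i, rfl⟩ := hlift j hj
      obtain ⟨i', rfl⟩ := hlift k hk
      rw [hqF, hqF, ← hA, ← hA, hutil, hutil, ← add_mul, ← add_mul]
      exact mul_le_mul_of_nonneg_right (hs'.2 i i') hDpos'.le

/-! ### Bit length of the encoded input and the polynomial time bound. -/

theorem size_lt_inputSize {l : List ℕ} {w : ℕ} (hw : w ∈ l) : w.size + 1 ≤ inputSize l :=
  List.single_le_sum (by simp) _ (List.mem_map_of_mem hw)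

theorem length_le_inputSize (l : List ℕ) : l.length ≤ inputSize l := by
  induction l with
  | nil => simp
  | cons w l ih =>
    simp only [inputSize, List.map_cons, List.sum_cons, List.length_cons] at ih ⊢
    omega

theorem inputStore_bounded (l : List ℕ) : (inputStore l).Bounded (inputSize l + 1) := by
  intro x k
  unfold inputStore
  split_ifs
  · rw [Int.natAbs_natCast]
    rcases lt_or_ge k.toNat (l.length :: l).length with h | h
    · rw [List.getD_eq_getElem _ _ h]
      have hmem := List.getElem_mem h
      rcases List.mem_cons.1 hmem with e | hmem
      · rw [e]
        exact (length_le_inputSize l).trans ((Nat.lt_two_pow_self).le.trans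
          (Nat.pow_le_pow_right (by norm_num) (by omega)))
      · exact (Nat.lt_size_self _).le.trans (Nat.pow_le_pow_right (by norm_num)
          (by have := size_lt_inputSize hmem; omega))
    · rw [List.getD_eq_default _ _ h]; simp
  · simp

theorem solvableInPolyTime :
    SolvableInPolyTime (fun I : (Σ n : ℕ, RatInstance n n) => I.2.encode)
      (fun I out => IsSolution I.2 out) := by
  obtain ⟨G, T, h⟩ := solve.exists_exec solve_wf
  refine ⟨solve.compile, T.comp (Polynomial.X + 1), fun ⟨n, I⟩ => ?_⟩
  obtain ⟨out, hout, hsol⟩ := exists_isSolution I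
  have hn : n ≤ inputSize I.encode + 1 := by
    have h1 := length_le_inputSize I.encode
    have h2 : I.encode.length = n * n + n * n + 2 := by simp [RatInstance.encode]
    have h3 := Nat.le_mul_self n
    omega
  obtain ⟨⟨t, ht, hle⟩, -⟩ := h (inputSize I.encode + 1) (inputSize I.encode + 1)
    (inputStore I.encode) n (by omega) le_rfl (inputStore_encode_one I) hn
    (inputStore_bounded _ 0) (inputStore_bounded _)
  exact ⟨t, _, out, ht, by simpa [Polynomial.eval_comp] using hle, hout, hsol⟩

end HouseAllocation

theorem proposition1 :
    HouseAllocation.SolvableInPolyTime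
        (fun I : (Σ n : ℕ, HouseAllocation.RatInstance n n) => I.2.encode)
        (fun I out => HouseAllocation.IsSolution I.2 out) ∧
      ∀ (n : ℕ) (u : Fin n → Fin n → ℝ), (∀ i h, 0 ≤ u i h) →
        ∀ a : Fin n ↪ Fin n, HouseAllocation.IsMaxWeight u a →
          (∃ s : Fin n → ℝ, HouseAllocation.IsMinEnvyEliminating u a s) ∧
            ∀ s : Fin n → ℝ, HouseAllocation.IsMinEnvyEliminating u a s →
              HouseAllocation.IsMinSubsidyEnvyFree u a s := by
  refine ⟨HouseAllocation.solvableInPolyTime, fun n u hu a ha => ⟨?_, fun s hs =>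
    hs.isMinSubsidyEnvyFree ha⟩⟩
  -- Some envy-free outcome exists by correctness of the algorithm and a limit; its prices are then
  -- carried over to the given maximum-weight allocation.
  obtain ⟨a', s', h'⟩ := HouseAllocation.exists_isEnvyFree_of_rat (fun I => by
    obtain ⟨out, -, a, num, den, -, -, h⟩ := HouseAllocation.exists_isSolution I
    exact ⟨a, _, h.1⟩) hu
  obtain ⟨s, hs, -⟩ := h'.transfer ha
  exact hs.exists_isMinEnvyEliminating
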